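/- Let $k\ge 2$. A finite hypergraph $\mathcal G=(V,E)$ consists of a finite vertex set $V$ and a set $E$ of non-empty subsets of $V$ (edges); it is $k$-uniform if every edge has exactly $k$ vertices. Two distinct vertices $u,v$ are adjacent, $u\sim v$, if some edge contains both. A path of length $p$ is a sequence $(u_1,e_1,u_2,\dots,e_p,u_{p+1})$ of distinct vertices and distinct edges with $u_i,u_{i+1}\in e_i$; a cycle is such a sequence with $p\ge 2$, distinct edges, $u_1,\dots,u_p$ distinct and $u_{p+1}=u_1$. A supertree is a (non-empty) connected hypergraph without cycles, and $\mathrm{dist}(u,v)$ is the length of a shortest path from $u$ to $v$. The degree $d(v)$ is the number of edges containing $v$; the degree sequence is the multiset of all degrees. The boundary $\partial V$ is the set of vertices of degree one, and $V^\circ=V\setminus\partial V$ is the set of interior vertices. For a multiset $\pi$ of natural numbers let $\mathcal T_\pi$ be the class of $k$-uniform supertrees with degree sequence $\pi$. The Laplacian of $\mathcal G$ is $L_{\mathcal G}=D-A$ with $D=\mathrm{diag}(d(v))$, $a_{ij}=\sum_{e\in E,\ \{i,j\}\subseteq e}\frac1{|e|-1}$ for $i\ne j$ and $a_{ii}=0$.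 A real $\lambda$ is a Dirichlet eigenvalue of $\mathcal G$ if there is a function $f\neq 0$ on $V$ with $L_{\mathcal G}f(u)=\lambda f(u)$ for all $u\in V^\circ$ and $f(u)=0$ for all $u\in\partial V$. Let $\lambda(\mathcal G)$ be the smallest Dirichlet eigenvalue (with $\lambda(\mathcal G)=0$ by convention if $V^\circ=\emptyset$, which for a supertree happens only if it consists of a single edge). A supertree $\mathcal G\in\mathcal T_\pi$ has the Faber--Krahn property in $\mathcal T_\pi$ if $\lambda(\mathcal G)\le\lambda(\mathcal G')$ for all $\mathcal G'\in\mathcal T_\pi$. Given a root $v_0\in V$, put $h(v)=\mathrm{dist}(v,v_0)$; $u$ is the parent of $v$ if $u\sim v$ and $h(v)=h(u)+1$. A supertree has an SLO-ordering (spiral-like ordering) if for some root $v_0$ there is a well-ordering $\prec$ of $V$ such that: (S1) $u\prec v$ implies $h(u)\le h(v)$; (S2) if $u,v$ are the parents of $u_1,v_1$ respectively and $u\prec v$, then $u_1\prec v_1$; (S3) if $u\prec v$ and $u\in\partial V$, then $v\in\partial V$; (S4) if $e=\{u_1,\dots,u_k\}\in E$ with $u_1\prec\dots\prec u_k$, then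 there is no $v\in V\setminus e$ with $u_i\prec v\prec u_{i+1}$ for some $2\le i\le k-1$; (S5) for $u,v\in V^\circ$, $u\prec v$ implies $d(u)\le d(v)$. Theorem. A supertree $\mathcal G\in\mathcal T_\pi$ has the Faber--Krahn property in $\mathcal T_\pi$ if and only if it has an SLO-ordering. Moreover, if $\mathcal T_\pi$ is non-empty, then a supertree with the Faber--Krahn property in $\mathcal T_\pi$ exists and is unique up to isomorphism. -/

import Mathlib

universe u

/-- A finite hypergraph with vertex set `V` and no multiple edges: a set of non-empty subsets
of `V`, the edges. -/
@[ext]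
structure FinHypergraph (V : Type u) where
  /-- The set of edges. -/
  edges : Finset (Finset V)
  /-- Edges are non-empty. -/
  nonempty_of_mem : ∀ e ∈ edges, e.Nonempty

namespace FinHypergraph

/-- Every edge has exactly `k` vertices. -/
def IsUniform {V : Type u} (G : FinHypergraph V) (k : ℕ) : Prop :=
  ∀ e ∈ G.edges, e.card = k

/-- The graph joining two distinct vertices whenever they share an edge. A walk in this graph is
a vertex-edge alternating sequence in the hypergraph; a shortest one repeats neither a vertex nor
an edge, so connectedness and distance in this graph are those given by paths of the hypergraph. -/
def adjGraph {V : Type u} (G : FinHypergraph V) : SimpleGraph V where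
  Adj x y := x ≠ y ∧ ∃ e ∈ G.edges, x ∈ e ∧ y ∈ e
  symm := ⟨fun _ _ h => ⟨h.1.symm, h.2.imp fun _ he => ⟨he.1, he.2.2, he.2.1⟩⟩⟩
  loopless := ⟨fun _ h => h.1 rfl⟩

/-- `G` contains a cycle `(u₀, e₀, u₁, e₁, …, u_{p-1}, e_{p-1}, u₀)` with `p = m + 2 ≥ 2`,
distinct vertices `uᵢ`, distinct edges `eᵢ` and `uᵢ, uᵢ₊₁ ∈ eᵢ`. The index `i + 1` is taken
cyclically, in `Fin (m + 2)`. -/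
def HasCycle {V : Type u} (G : FinHypergraph V) : Prop :=
  ∃ (m : ℕ) (x : Fin (m + 2) → V) (e : Fin (m + 2) → Finset V),
    Function.Injective x ∧ Function.Injective e ∧
      ∀ i, e i ∈ G.edges ∧ x i ∈ e i ∧ x (i + 1) ∈ e i

/-- A supertree is a connected (in particular non-empty) acyclic hypergraph. -/
def IsSupertree {V : Type u} (G : FinHypergraph V) : Prop :=
  G.adjGraph.Connected ∧ ¬ G.HasCycle

/-- The number of edges that contain `v`. -/
def degree {V : Type u} [DecidableEq V] (G : FinHypergraph V) (v : V) : ℕ :=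
  (G.edges.filter fun e => v ∈ e).card

/-- The list of the degrees of all vertices, up to order. -/
def degreeSequence {V : Type u} [Fintype V] [DecidableEq V] (G : FinHypergraph V) : Multiset ℕ :=
  (Finset.univ : Finset V).val.map G.degree

/-- The boundary consists of the vertices of degree one; the other vertices are interior. -/
def IsBoundary {V : Type u} [DecidableEq V] (G : FinHypergraph V) (v : V) : Prop :=
  G.degree v = 1

/-- Membership in the class `T_π` of `k`-uniform supertrees with degree sequence `π`. -/
structure MemClass {V : Type u} [Fintype V] [DecidableEq V] (G : FinHypergraph V) (k : ℕ)
    (π : Multiset ℕ) : Prop where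
  isUniform : G.IsUniform k
  isSupertree : G.IsSupertree
  degreeSequence_eq : G.degreeSequence = π

/-- Banerjee's adjacency matrix: `a i j = ∑ 1 / (|e| - 1)` over the edges `e ⊇ {i, j}` for
`i ≠ j` (an empty sum if `i` and `j` are not adjacent), and `a i i = 0`. -/
noncomputable def adjMatrix {V : Type u} [DecidableEq V] (G : FinHypergraph V) : Matrix V V ℝ :=
  Matrix.of fun i j =>
    if i = j then 0
    else ∑ e ∈ G.edges.filter (fun e => i ∈ e ∧ j ∈ e), 1 / ((e.card : ℝ) - 1)

/-- The Laplacian matrix `L = D - A`. -/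
noncomputable def lapMatrix {V : Type u} [DecidableEq V] (G : FinHypergraph V) : Matrix V V ℝ :=
  Matrix.diagonal (fun v => (G.degree v : ℝ)) - G.adjMatrix

/-- `μ` is a Dirichlet eigenvalue: there is `f ≠ 0` with `L f = μ f` at all interior vertices and
`f = 0` at all boundary vertices. -/
def IsDirichletEigenvalue {V : Type u} [Fintype V] [DecidableEq V] (G : FinHypergraph V)
    (μ : ℝ) : Prop :=
  ∃ f : V → ℝ, f ≠ 0 ∧ (∀ v, ¬ G.IsBoundary v → G.lapMatrix.mulVec f v = μ * f v) ∧
    ∀ v, G.IsBoundary v → f v = 0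

/-- The first (smallest) Dirichlet eigenvalue. If there is at least one interior vertex, the set
is finite and non-empty; without interior vertices it is empty and the value is `0`. -/
noncomputable def firstDirichletEigenvalue {V : Type u} [Fintype V] [DecidableEq V]
    (G : FinHypergraph V) : ℝ :=
  sInf {μ : ℝ | G.IsDirichletEigenvalue μ}

/-- The Faber–Krahn property in `T_π`: `G` belongs to `T_π`, and its first Dirichlet eigenvalue is
minimal among those of all members of `T_π`. -/
def HasFaberKrahn {V : Type u} [Fintype V] [DecidableEq V] (G : FinHypergraph V) (k : ℕ)
    (π : Multiset ℕ) : Prop :=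
  G.MemClass k π ∧
    ∀ (W : Type u) [Fintype W] [DecidableEq W] (H : FinHypergraph W), H.MemClass k π →
      G.firstDirichletEigenvalue ≤ H.firstDirichletEigenvalue

/-- The height of `v` with respect to a root: its distance from the root. -/
noncomputable def height {V : Type u} (G : FinHypergraph V) (root v : V) : ℕ :=
  G.adjGraph.dist v root

/-- `p` is the parent of `c` (and `c` a child of `p`) with respect to a root. -/
def IsParent {V : Type u} (G : FinHypergraph V) (root p c : V) : Prop :=
  G.adjGraph.Adj p c ∧ G.height root c = G.height root p + 1

/-- The well-ordering `r` (written `≺` below) is a spiral-like ordering of `G` with root `root`. -/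
structure IsSLO {V : Type u} [DecidableEq V] (G : FinHypergraph V) (root : V)
    (r : V → V → Prop) : Prop where
  /-- `≺` is a (strict) well-ordering. -/
  isWellOrder : IsWellOrder V r
  /-- (S1) `u ≺ v` implies `h u ≤ h v`. -/
  s1 : ∀ u v, r u v → G.height root u ≤ G.height root v
  /-- (S2) If `u`, `v` are the parents of `u₁`, `v₁` and `u ≺ v`, then `u₁ ≺ v₁`. -/
  s2 : ∀ u v u₁ v₁, G.IsParent root u u₁ → G.IsParent root v v₁ → r u v → r u₁ v₁
  /-- (S3) If `u ≺ v` and `u` is a boundary vertex, then so is `v`. -/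
  s3 : ∀ u v, r u v → G.IsBoundary u → G.IsBoundary v
  /-- (S4) The vertices of an edge other than its `≺`-least one are consecutive: a vertex strictly
  between two vertices `x ≺ y` of `e`, where `x` is not the least vertex of `e`, lies in `e`. -/
  s4 : ∀ e ∈ G.edges, ∀ a ∈ e, ∀ x ∈ e, ∀ y ∈ e, r a x → ∀ v, r x v → r v y → v ∈ e
  /-- (S5) For interior vertices, `u ≺ v` implies `d u ≤ d v`. -/
  s5 : ∀ u v, ¬ G.IsBoundary u → ¬ G.IsBoundary v → r u v → G.degree u ≤ G.degree v

/-- `G` has an SLO-ordering, for some choice of the root. -/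
def HasSLO {V : Type u} [DecidableEq V] (G : FinHypergraph V) : Prop :=
  ∃ (root : V) (r : V → V → Prop), G.IsSLO root r

/-- `G` and `H` are isomorphic: a bijection of the vertices maps edges to edges, both ways. -/
def IsIsomorphic {V W : Type u} (G : FinHypergraph V) (H : FinHypergraph W) : Prop :=
  ∃ φ : V ≃ W, ∀ e : Finset V, e ∈ G.edges ↔ e.map φ.toEmbedding ∈ H.edges

end FinHypergraph

set_option linter.unusedSectionVars false

namespace FinHypergraph

variable {V : Type u}

/-! ### Paths that avoid prescribed edges -/

section Linked

/-! The analytic content is one implication: the Faber–Krahn property forces an SLO-ordering. The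
rest is formal. Up to isomorphism `T_π` is finite, because its members all have `|π|` vertices, so a
minimizer exists. Two members of `T_π` with SLO-orderings are isomorphic. Hence a member with an
SLO-ordering is isomorphic to a minimizer and is itself one.

For the implication, `(k - 1) λ` is the minimum of the Rayleigh quotient with energy `∑ₑ (k ∑ f² -
(∑ f)²)`, over functions vanishing on the boundary, and it is attained by an `f` positive in the
interior. Call `∑_{x ∈ e} f x` the weight of `e`. Exchanging `a ∈ e₁` with `b ∈ e₂` changes the
energy of `f` by `-2 (f b - f a)` times the difference of the weights of `e₁ \ a` and `e₂ \ b`. If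
the result is still a supertree, minimality yields two rules (`Swappable.sum_le_and_eq`): `f a < f
b` makes `e₂` heavier than `e₁`, and `f a = f b > 0` makes the weights equal, since `f` then solves
the eigenvalue equation of both hypergraphs. Acyclicity after a move is automatic: a connected
`k`-uniform hypergraph with the vertex and edge counts of a supertree is a supertree.

With the root at a maximum of `f`, the rules show that `f` decreases with height, that vertices of
equal height compare like their parents, and that children of one vertex compare like the weights of
their edges. Ordering by height, then by parents, then by edge weight gives (S1)–(S4). If
consecutive interior vertices `u ≺ v` had `d(u) > d(v)`, moving `d(u) - d(v)` child edges from `u`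
to `v` would exchange the two degrees without raising the energy, and the equality case is excluded
by the eigenvalue equation at `u`; this is (S5).

For uniqueness, (S3) and (S5) determine the degree at each position. By (S4) the lower vertices of
the edges follow one another in blocks of `k - 1`, and by (S2) the blocks are attached in the order
of their parents. Positions and degrees therefore determine every edge (`IsSLO.map_mem_edges`). -/

theorem reachable_of_mem {G : FinHypergraph V} {e : Finset V} (he : e ∈ G.edges) {x y : V}
    (hx : x ∈ e) (hy : y ∈ e) : G.adjGraph.Reachable x y := by
  by_cases h : x = y
  · exact h ▸ SimpleGraph.Reachable.refl _
  · exact SimpleGraph.Adj.reachable ⟨h, e, he, hx, hy⟩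

theorem reachable_of_forall_edge {G H : FinHypergraph V}
    (h : ∀ e ∈ G.edges, ∀ x ∈ e, ∀ y ∈ e, H.adjGraph.Reachable x y) {u v : V}
    (huv : G.adjGraph.Reachable u v) : H.adjGraph.Reachable u v := by
  obtain ⟨w⟩ := huv
  induction w with
  | nil => exact SimpleGraph.Reachable.refl _
  | cons hadj _ ih =>
    obtain ⟨-, e, he, hx, hy⟩ := hadj
    exact (h e he _ hx _ hy).trans ih

open Classical in
/-- The subhypergraph of `G` formed by the edges that satisfy `P`. -/
noncomputable def restrict (G : FinHypergraph V) (P : Finset V → Prop) : FinHypergraph V where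
  edges := G.edges.filter P
  nonempty_of_mem e he := G.nonempty_of_mem e (Finset.mem_filter.1 he).1

theorem mem_restrict {G : FinHypergraph V} {P : Finset V → Prop} {e : Finset V} :
    e ∈ (G.restrict P).edges ↔ e ∈ G.edges ∧ P e := by
  classical
  simp [restrict]

/-- `x` and `y` are joined by a path all of whose edges satisfy `P`. -/
def Linked (G : FinHypergraph V) (P : Finset V → Prop) (x y : V) : Prop :=
  (G.restrict P).adjGraph.Reachable x y

theorem Linked.refl {G : FinHypergraph V} {P : Finset V → Prop} (x : V) : G.Linked P x x :=
  SimpleGraph.Reachable.refl _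

theorem Linked.symm {G : FinHypergraph V} {P : Finset V → Prop} {x y : V} (h : G.Linked P x y) :
    G.Linked P y x :=
  SimpleGraph.Reachable.symm h

theorem Linked.trans {G : FinHypergraph V} {P : Finset V → Prop} {x y z : V}
    (h : G.Linked P x y) (h' : G.Linked P y z) : G.Linked P x z :=
  SimpleGraph.Reachable.trans h h'

theorem linked_of_mem {G : FinHypergraph V} {P : Finset V → Prop} {e : Finset V}
    (he : e ∈ G.edges) (hP : P e) {x y : V} (hx : x ∈ e) (hy : y ∈ e) : G.Linked P x y :=
  reachable_of_mem (mem_restrict.2 ⟨he, hP⟩) hx hy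

theorem Linked.reachable {G H : FinHypergraph V} {P : Finset V → Prop}
    (h : ∀ e ∈ G.edges, P e → e ∈ H.edges) {x y : V} (hxy : G.Linked P x y) :
    H.adjGraph.Reachable x y :=
  reachable_of_forall_edge
    (fun e he _ hx _ hy => reachable_of_mem (h e (mem_restrict.1 he).1 (mem_restrict.1 he).2) hx hy)
    hxy

theorem Linked.mono {G : FinHypergraph V} {P Q : Finset V → Prop}
    (h : ∀ e ∈ G.edges, P e → Q e) {x y : V} (hxy : G.Linked P x y) : G.Linked Q x y :=
  Linked.reachable (fun e he hP => mem_restrict.2 ⟨he, h e he hP⟩) hxy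

/-- Two vertices of an edge that are also joined by a path avoiding that edge lie on a cycle. -/
theorem hasCycle_of_linked {G : FinHypergraph V} {e : Finset V} (he : e ∈ G.edges) {u v : V}
    (hu : u ∈ e) (hv : v ∈ e) (huv : u ≠ v) (h : G.Linked (· ≠ e) u v) : G.HasCycle := by
  obtain ⟨w, hw⟩ := SimpleGraph.Reachable.exists_walk_length_eq_dist h
  have hpath := w.isPath_of_length_eq_dist hw
  have hadj : ∀ i, ∃ c, i < w.length → c ∈ G.edges ∧ c ≠ e ∧ w.getVert i ∈ c ∧
      w.getVert (i + 1) ∈ c := by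
    intro i
    by_cases hi : i < w.length
    · obtain ⟨-, c, hc, h1, h2⟩ := w.adj_getVert_succ hi
      exact ⟨c, fun _ => ⟨(mem_restrict.1 hc).1, (mem_restrict.1 hc).2, h1, h2⟩⟩
    · exact ⟨e, fun h => absurd h hi⟩
  choose c hc using hadj
  have hinj : ∀ i j, i < j → j < w.length → c i ≠ c j := by
    intro i j hij hj heq
    have h1 := hc i (hij.trans hj)
    have h2 := hc j hj
    have hne : w.getVert i ≠ w.getVert (j + 1) := fun h3 => by
      have := hpath.getVert_injOn (by simp; omega) (by simp; omega) h3
      omega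
    -- An edge used twice would give this shortcut in a shortest walk.
    have hA : (G.restrict (· ≠ e)).adjGraph.Adj (w.getVert i) (w.getVert (j + 1)) :=
      ⟨hne, c i, mem_restrict.2 ⟨h1.1, h1.2.1⟩, h1.2.2.1, heq ▸ h2.2.2.2⟩
    have := SimpleGraph.dist_le ((w.take i).append (SimpleGraph.Walk.cons hA (w.drop (j + 1))))
    simp only [SimpleGraph.Walk.length_append, SimpleGraph.Walk.length_cons,
      SimpleGraph.Walk.take_length, SimpleGraph.Walk.drop_length] at this
    omega
  have hpos : 0 < w.length := by
    rcases Nat.eq_zero_or_pos w.length with h0 | h0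
    · exact absurd (SimpleGraph.Walk.eq_of_length_eq_zero h0) huv
    · exact h0
  obtain ⟨m, hm⟩ : ∃ m, w.length = m + 1 := ⟨w.length - 1, by omega⟩
  refine ⟨m, fun i => w.getVert i, fun i => if (i : ℕ) < m + 1 then c i else e, ?_, ?_, ?_⟩
  · intro i j hij
    exact Fin.ext (hpath.getVert_injOn (by simp; omega) (by simp; omega) hij)
  · intro i j hij
    simp only at hij
    split_ifs at hij with h1 h2 h2
    · rcases lt_trichotomy (i : ℕ) j with h3 | h3 | h3
      · exact absurd hij (hinj _ _ h3 (by omega))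
      · exact Fin.ext h3
      · exact absurd hij.symm (hinj _ _ h3 (by omega))
    · exact absurd hij (hc i (by omega)).2.1
    · exact absurd hij.symm (hc j (by omega)).2.1
    · exact Fin.ext (by omega)
  · intro i
    by_cases h1 : (i : ℕ) < m + 1
    · have h2 : ((i + 1 : Fin (m + 2)) : ℕ) = i + 1 := by
        rw [Fin.val_add_one_of_lt]
        rw [Fin.lt_def]; simpa using h1
      have h3 := hc i (by omega)
      simp only [h1, if_true, h2]
      exact ⟨h3.1, h3.2.2⟩
    -- The last index wraps around to `0`: the edge `e` closes the path from `v` back to `u`.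
    · have h2 : i = Fin.last (m + 1) := Fin.ext (by simp; omega)
      have h3 : w.getVert (m + 1) = v := hm ▸ w.getVert_length
      subst h2
      simp [he, hu, hv, h3]

end Linked

/-! ### Heights above a root -/

section Height

variable {G : FinHypergraph V} {root : V}

@[simp]
theorem height_root : G.height root root = 0 := by simp [height]

theorem height_eq_zero (hG : G.adjGraph.Connected) {v : V} : G.height root v = 0 ↔ v = root :=
  hG.dist_eq_zero_iff

theorem height_le_of_mem (hG : G.adjGraph.Connected) {e : Finset V} (he : e ∈ G.edges) {x y : V}
    (hx : x ∈ e) (hy : y ∈ e) : G.height root x ≤ G.height root y + 1 := by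
  by_cases h : x = y
  · simp [h]
  · have h1 : G.adjGraph.dist x y = 1 := SimpleGraph.dist_eq_one_iff_adj.2 ⟨h, e, he, hx, hy⟩
    have h2 := hG.dist_triangle (u := x) (v := y) (w := root)
    simp only [height]
    omega

theorem exists_edge_height_lt (hG : G.adjGraph.Connected) {v : V} (hv : v ≠ root) :
    ∃ e ∈ G.edges, v ∈ e ∧ ∃ p ∈ e, G.height root v = G.height root p + 1 := by
  obtain ⟨w, hw⟩ := hG.exists_walk_length_eq_dist v root
  cases w with
  | nil => exact absurd rfl hv
  | cons hadj w' =>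
    rename_i p
    have hadj' := hadj
    obtain ⟨-, e, he, hx, hy⟩ := hadj'
    refine ⟨e, he, hx, p, hy, ?_⟩
    have h1 := SimpleGraph.dist_le w'
    have h2 := height_le_of_mem (root := root) hG he hx hy
    simp only [SimpleGraph.Walk.length_cons] at hw
    simp only [height] at *
    omega

/-- Follow a shortest path to the root. The condition on edges serves to avoid them: an edge all of
whose vertices are at least as high as `v` is not on this path. -/
theorem linked_root (hG : G.adjGraph.Connected) (v : V) :
    G.Linked (fun e => ∃ p ∈ e, G.height root p < G.height root v) v root := by
  induction hn : G.height root v using Nat.strong_induction_on generalizing v with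
  | _ n ih =>
    by_cases hv : v = root
    · exact hv ▸ Linked.refl _
    · obtain ⟨e, he, hve, p, hp, hh⟩ := exists_edge_height_lt hG hv
      refine (linked_of_mem he ⟨p, hp, by omega⟩ hve hp).trans ?_
      refine (ih _ (by omega) p rfl).mono ?_
      rintro e - ⟨q, hq, h⟩
      exact ⟨q, hq, by omega⟩

end Height

theorem eq_of_isBoundary [DecidableEq V] {G : FinHypergraph V} {v : V} (hv : G.IsBoundary v) {e e' : Finset V}
    (he : e ∈ G.edges) (he' : e' ∈ G.edges) (h : v ∈ e) (h' : v ∈ e') : e = e' :=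
  Finset.card_le_one.1 (le_of_eq hv) e (Finset.mem_filter.2 ⟨he, h⟩) e'
    (Finset.mem_filter.2 ⟨he', h'⟩)

end FinHypergraph

/-! ### The rooted tree structure of a supertree -/

namespace FinHypergraph

variable {V : Type u}

/-- The tree structure of a supertree seen from a root: every edge `e` has a single vertex `top e`
closest to the root, and every vertex `v` other than the root is a lower vertex of the single edge
`par v`. -/
structure Rooting (G : FinHypergraph V) (root : V) where
  /-- The vertex of an edge closest to the root. -/
  top : Finset V → V
  /-- The edge joining a vertex to its parent. -/
  par : V → Finset V
  connected : G.adjGraph.Connected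
  top_mem : ∀ e ∈ G.edges, top e ∈ e
  height_eq : ∀ e ∈ G.edges, ∀ x ∈ e, x ≠ top e → G.height root x = G.height root (top e) + 1
  par_mem : ∀ v, v ≠ root → par v ∈ G.edges
  mem_par : ∀ v, v ≠ root → v ∈ par v
  ne_top_par : ∀ v, v ≠ root → v ≠ top (par v)
  par_eq : ∀ e ∈ G.edges, ∀ x ∈ e, x ≠ top e → par x = e

/-- A supertree has a rooting at each of its vertices. -/
theorem IsSupertree.nonempty_rooting {G : FinHypergraph V} (hG : G.IsSupertree) (root : V) :
    Nonempty (G.Rooting root) := by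
  classical
  obtain ⟨hc, hcyc⟩ := hG
  have htop : ∀ e, ∃ t, e ∈ G.edges → t ∈ e ∧ ∀ x ∈ e, G.height root t ≤ G.height root x := by
    intro e
    by_cases he : e ∈ G.edges
    · obtain ⟨t, ht, h⟩ := e.exists_min_image (G.height root) (G.nonempty_of_mem e he)
      exact ⟨t, fun _ => ⟨ht, h⟩⟩
    · exact ⟨root, fun h => absurd h he⟩
  choose top htop using htop
  have hlow : ∀ v, ∃ e, v ≠ root → e ∈ G.edges ∧ v ∈ e ∧ v ≠ top e := by
    intro v
    by_cases hv : v = root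
    · exact ⟨∅, fun h => absurd hv h⟩
    · obtain ⟨e, he, hve, p, hp, h⟩ := exists_edge_height_lt hc hv
      refine ⟨e, fun _ => ⟨he, hve, ?_⟩⟩
      intro h1
      have := (htop e he).2 p hp
      rw [← h1] at this
      omega
  choose par hpar using hlow
  -- Two vertices of minimal height in `e` both reach the root without using `e`, which produces a
  -- cycle.
  have hlt : ∀ e ∈ G.edges, ∀ x ∈ e, x ≠ top e →
      G.height root x = G.height root (top e) + 1 := by
    intro e he x hx hxt
    have h1 := (htop e he).2 x hx
    have h2 := height_le_of_mem (root := root) hc he hx (htop e he).1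
    by_contra hne
    have h3 : G.height root x = G.height root (top e) := by omega
    apply hcyc
    refine hasCycle_of_linked he hx (htop e he).1 hxt ?_
    have avoid : ∀ y ∈ e, G.height root y = G.height root (top e) →
        G.Linked (· ≠ e) y root := by
      intro y hy hyt
      refine (linked_root hc y).mono ?_
      rintro e' - ⟨p, hp, h4⟩ rfl
      have := (htop e' he).2 p hp
      omega
    exact (avoid x hx h3).trans (avoid _ (htop e he).1 rfl).symm
  -- If `x` were below the tops of two edges, then `e'`, followed by paths from the two tops to the
  -- root, would join `x` to `top e` without using `e`.
  have huniq : ∀ e ∈ G.edges, ∀ e' ∈ G.edges, ∀ x ∈ e, x ∈ e' → x ≠ top e → x ≠ top e' →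
      e' = e := by
    intro e he e' he' x hx hx' hxt hxt'
    by_contra hne
    have h1 := hlt e he x hx hxt
    have h2 := hlt e' he' x hx' hxt'
    apply hcyc
    refine hasCycle_of_linked he hx (htop e he).1 hxt ?_
    have avoid : ∀ y, G.height root y = G.height root (top e) → G.Linked (· ≠ e) y root := by
      intro y hyt
      refine (linked_root hc y).mono ?_
      rintro c - ⟨p, hp, h4⟩ rfl
      have := (htop c he).2 p hp
      omega
    exact ((linked_of_mem he' hne hx' (htop e' he').1).trans (avoid _ (by omega))).trans
      (avoid _ rfl).symm
  exact ⟨{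
    top := top
    par := par
    connected := hc
    top_mem := fun e he => (htop e he).1
    height_eq := hlt
    par_mem := fun v hv => (hpar v hv).1
    mem_par := fun v hv => (hpar v hv).2.1
    ne_top_par := fun v hv => (hpar v hv).2.2
    par_eq := fun e he x hx hxt => by
      have hx0 : x ≠ root := by
        rintro rfl
        have := hlt e he x hx hxt
        simp at this
      obtain ⟨h1, h2, h3⟩ := hpar x hx0
      exact huniq e he _ h1 x hx h2 hxt h3 }⟩

namespace Rooting

variable {G : FinHypergraph V} {root : V}

theorem ne_root (T : G.Rooting root) {e : Finset V} (he : e ∈ G.edges) {x : V} (hx : x ∈ e)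
    (hxt : x ≠ T.top e) : x ≠ root := by
  rintro rfl
  have := T.height_eq e he x hx hxt
  simp at this

theorem height_par (T : G.Rooting root) {v : V} (hv : v ≠ root) :
    G.height root v = G.height root (T.top (T.par v)) + 1 :=
  T.height_eq _ (T.par_mem v hv) v (T.mem_par v hv) (T.ne_top_par v hv)

theorem top_par_mem (T : G.Rooting root) {v : V} (hv : v ≠ root) : T.top (T.par v) ∈ T.par v :=
  T.top_mem _ (T.par_mem v hv)

theorem isParent_iff (T : G.Rooting root) {p c : V} :
    G.IsParent root p c ↔ c ≠ root ∧ p = T.top (T.par c) := by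
  constructor
  · rintro ⟨⟨-, e, he, hp, hc⟩, h⟩
    have hct : c ≠ T.top e := by
      intro h1
      by_cases hpt : p = T.top e
      · rw [hpt, ← h1] at h; omega
      · have := T.height_eq e he p hp hpt
        rw [← h1] at this; omega
    refine ⟨T.ne_root he hc hct, ?_⟩
    rw [T.par_eq e he c hc hct]
    by_contra hpt
    have := T.height_eq e he p hp hpt
    have := T.height_eq e he c hc hct
    omega
  · rintro ⟨hc, rfl⟩
    exact ⟨⟨(T.ne_top_par c hc).symm, T.par c, T.par_mem c hc, T.top_par_mem hc, T.mem_par c hc⟩,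
      T.height_par hc⟩

/-- A hypergraph with a rooting has no cycles. -/
theorem isSupertree (T : G.Rooting root) : G.IsSupertree := by
  refine ⟨T.connected, ?_⟩
  rintro ⟨m, x, e, hx, he, h⟩
  -- An edge of the cycle whose top is highest meets the other edges of the cycle at most in its
  -- top, yet it shares two different vertices with its neighbours.
  obtain ⟨i, -, hi⟩ := (Finset.univ : Finset (Fin (m + 2))).exists_max_image
    (fun i => G.height root (T.top (e i))) ⟨0, Finset.mem_univ _⟩
  have hne : x i ≠ x (i + 1) := fun h1 => by
    have := hx h1
    simp at this
  have key : ∀ j, e j ≠ e i → ∀ y ∈ e i, y ∈ e j → y = T.top (e i) := by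
    intro j hj y hy hy'
    by_contra hyt
    have h1 := T.height_eq _ (h i).1 y hy hyt
    by_cases hyt' : y = T.top (e j)
    · have := hi j (Finset.mem_univ _)
      rw [← hyt'] at this
      omega
    · exact hj ((T.par_eq _ (h j).1 y hy' hyt').symm.trans (T.par_eq _ (h i).1 y hy hyt))
  have h1 : x (i + 1) = T.top (e i) :=
    key (i + 1) (fun h2 => by have := he h2; simp at this) _ (h i).2.2 (h (i + 1)).2.1
  have h2 : x i = T.top (e i) := by
    refine key (i - 1) (fun h2 => by have := he h2; simp at this) _ (h i).2.1 ?_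
    have := (h (i - 1)).2.2
    simpa using this
  exact hne (h2.trans h1.symm)

end Rooting

/-! ### Supertrees characterized by counting vertices -/

section Count

variable [Fintype V]

/-- A connected hypergraph has at most `∑ (|e| - 1) + 1` vertices, and a rooting in the case of
equality: the vertices are counted along parent edges. -/
theorem card_le_and_nonempty_rooting_of_connected [DecidableEq V] {G : FinHypergraph V} (hG : G.adjGraph.Connected)
    (root : V) :
    Fintype.card V ≤ ∑ e ∈ G.edges, (e.card - 1) + 1 ∧
      (Fintype.card V = ∑ e ∈ G.edges, (e.card - 1) + 1 → Nonempty (G.Rooting root)) := by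
  have htop : ∀ e, ∃ t, e ∈ G.edges → t ∈ e ∧ ∀ x ∈ e, G.height root t ≤ G.height root x := by
    intro e
    by_cases he : e ∈ G.edges
    · obtain ⟨t, ht, h⟩ := e.exists_min_image (G.height root) (G.nonempty_of_mem e he)
      exact ⟨t, fun _ => ⟨ht, h⟩⟩
    · exact ⟨root, fun h => absurd h he⟩
  choose top htop using htop
  have hlow : ∀ v, ∃ e, v ≠ root → e ∈ G.edges ∧ v ∈ e ∧
      ∃ p ∈ e, G.height root v = G.height root p + 1 := by
    intro v
    by_cases hv : v = root
    · exact ⟨∅, fun h => absurd hv h⟩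
    · obtain ⟨e, he, hve, h⟩ := exists_edge_height_lt hG hv
      exact ⟨e, fun _ => ⟨he, hve, h⟩⟩
  choose par hpar using hlow
  let fiber : Finset V → Finset V := fun e => (Finset.univ.erase root).filter fun v => par v = e
  have hsub : ∀ e ∈ G.edges, fiber e ⊆ e.erase (top e) := by
    intro e he v hv
    simp only [fiber, Finset.mem_filter, Finset.mem_erase, Finset.mem_univ, and_true] at hv
    obtain ⟨hv0, rfl⟩ := hv
    obtain ⟨h1, h2, p, hp, h3⟩ := hpar v hv0
    refine Finset.mem_erase.2 ⟨fun h4 => ?_, h2⟩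
    have := (htop _ he).2 p hp
    rw [← h4] at this
    omega
  have hle : ∀ e ∈ G.edges, (fiber e).card ≤ e.card - 1 := by
    intro e he
    rw [← Finset.card_erase_of_mem (htop e he).1]
    exact Finset.card_le_card (hsub e he)
  have hsum : Fintype.card V = ∑ e ∈ G.edges, (fiber e).card + 1 := by
    have h1 := Finset.card_eq_sum_card_fiberwise (s := Finset.univ.erase root) (t := G.edges)
      (f := par) (fun v hv => (hpar v (Finset.ne_of_mem_erase hv)).1)
    rw [← h1, Finset.card_erase_of_mem (Finset.mem_univ _), Finset.card_univ]
    have : 0 < Fintype.card V := Fintype.card_pos_iff.2 ⟨root⟩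
    omega
  -- The fibers of `par` partition the vertices other than the root, and the fiber of `e` misses
  -- `top e`. Equality forces each fiber to be all of `e` except its top, which is the defining
  -- property of a rooting.
  refine ⟨hsum ▸ Nat.add_le_add_right (Finset.sum_le_sum hle) 1, fun heq => ?_⟩
  have heq' := (Finset.sum_eq_sum_iff_of_le hle).1 (by omega)
  have hfib : ∀ e ∈ G.edges, fiber e = e.erase (top e) := by
    intro e he
    refine Finset.eq_of_subset_of_card_le (hsub e he) ?_
    rw [heq' e he, Finset.card_erase_of_mem (htop e he).1]
  have hmem : ∀ e ∈ G.edges, ∀ x ∈ e, x ≠ top e → x ≠ root ∧ par x = e := by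
    intro e he x hx hxt
    have : x ∈ fiber e := by
      rw [hfib e he]; exact Finset.mem_erase.2 ⟨hxt, hx⟩
    simpa [fiber] using this
  exact ⟨{
    top := top
    par := par
    connected := hG
    top_mem := fun e he => (htop e he).1
    height_eq := fun e he x hx hxt => by
      obtain ⟨h1, h2⟩ := hmem e he x hx hxt
      obtain ⟨-, -, p, hp, h3⟩ := hpar x h1
      rw [h2] at hp
      have h4 := (htop e he).2 p hp
      have h5 := height_le_of_mem (root := root) hG he hx (htop e he).1
      omega
    par_mem := fun v hv => (hpar v hv).1
    mem_par := fun v hv => (hpar v hv).2.1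
    ne_top_par := fun v hv => by
      intro h4
      obtain ⟨h1, h2, p, hp, h3⟩ := hpar v hv
      have := (htop _ h1).2 p hp
      rw [← h4] at this
      omega
    par_eq := fun e he x hx hxt => (hmem e he x hx hxt).2 }⟩

theorem card_le_of_connected {G : FinHypergraph V} (hG : G.adjGraph.Connected) :
    Fintype.card V ≤ ∑ e ∈ G.edges, (e.card - 1) + 1 := by
  classical
  obtain ⟨root⟩ := hG.nonempty
  exact (card_le_and_nonempty_rooting_of_connected hG root).1

/-- This removes acyclicity from later constructions: after a move of edges only connectedness and
the count have to be checked. -/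
theorem isSupertree_of_card_eq {G : FinHypergraph V} (hG : G.adjGraph.Connected)
    (h : Fintype.card V = ∑ e ∈ G.edges, (e.card - 1) + 1) : G.IsSupertree := by
  classical
  obtain ⟨root⟩ := hG.nonempty
  obtain ⟨T⟩ := (card_le_and_nonempty_rooting_of_connected hG root).2 h
  exact T.isSupertree

namespace Rooting

variable {G : FinHypergraph V} {root : V}

theorem filter_par_eq [DecidableEq V] (T : G.Rooting root) {e : Finset V} (he : e ∈ G.edges) :
    (Finset.univ.filter fun v => v ≠ root ∧ T.par v = e) = e.erase (T.top e) := by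
  ext v
  simp only [Finset.mem_filter, Finset.mem_univ, true_and, Finset.mem_erase]
  constructor
  · rintro ⟨hv, rfl⟩
    exact ⟨T.ne_top_par v hv, T.mem_par v hv⟩
  · rintro ⟨h1, h2⟩
    exact ⟨T.ne_root he h2 h1, T.par_eq e he v h2 h1⟩

theorem card_eq (T : G.Rooting root) :
    Fintype.card V = ∑ e ∈ G.edges, (e.card - 1) + 1 := by
  classical
  have h1 := Finset.card_eq_sum_card_fiberwise (s := Finset.univ.erase root) (t := G.edges)
    (f := T.par) (fun v hv => T.par_mem v (Finset.ne_of_mem_erase hv))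
  rw [Finset.card_erase_of_mem (Finset.mem_univ _), Finset.card_univ] at h1
  have h2 : ∀ e ∈ G.edges, ((Finset.univ.erase root).filter fun v => T.par v = e).card =
      e.card - 1 := by
    intro e he
    rw [← Finset.card_erase_of_mem (T.top_mem e he), ← T.filter_par_eq he]
    congr 1
    ext v
    simp
  rw [Finset.sum_congr rfl h2] at h1
  have : 0 < Fintype.card V := Fintype.card_pos_iff.2 ⟨root⟩
  omega

end Rooting

theorem IsSupertree.card_eq {G : FinHypergraph V} (hG : G.IsSupertree) :
    Fintype.card V = ∑ e ∈ G.edges, (e.card - 1) + 1 := by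
  obtain ⟨root⟩ := hG.1.nonempty
  obtain ⟨T⟩ := hG.nonempty_rooting root
  exact T.card_eq

end Count

/-! ### Descendants and paths between edges -/

namespace Rooting

variable {G : FinHypergraph V} {root : V}

/-- `v` is a descendant of `q` (possibly `q` itself). -/
def Desc (T : G.Rooting root) (v q : V) : Prop :=
  Relation.ReflTransGen (fun x y => x ≠ root ∧ y = T.top (T.par x)) v q

theorem Desc.height_le {T : G.Rooting root} {v q : V} (h : T.Desc v q) :
    G.height root q ≤ G.height root v := by
  induction h with
  | refl => exact le_rfl
  | tail _ h ih =>
    obtain ⟨h1, rfl⟩ := h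
    have := T.height_par h1
    omega

/-- The path climbs through parent edges. The bounds on the heights of their tops tell which edges
it cannot contain. -/
theorem Desc.linked {T : G.Rooting root} {v q : V} (h : T.Desc v q) :
    G.Linked (fun e => G.height root q ≤ G.height root (T.top e) ∧
      G.height root (T.top e) < G.height root v) v q := by
  induction h using Relation.ReflTransGen.head_induction_on with
  | refl => exact Linked.refl _
  | head h1 h2 ih =>
    obtain ⟨h3, rfl⟩ := h1
    have h4 := T.height_par h3
    have h5 := Desc.height_le h2
    refine (linked_of_mem (T.par_mem _ h3) ⟨h5, by omega⟩ (T.mem_par _ h3)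
      (T.top_par_mem h3)).trans (ih.mono ?_)
    rintro e - ⟨h6, h7⟩
    exact ⟨h6, by omega⟩

theorem desc_top (T : G.Rooting root) {e : Finset V} (he : e ∈ G.edges) {x : V} (hx : x ∈ e) :
    T.Desc x (T.top e) := by
  by_cases h : x = T.top e
  · exact h ▸ Relation.ReflTransGen.refl
  · refine Relation.ReflTransGen.single ⟨T.ne_root he hx h, ?_⟩
    rw [T.par_eq e he x hx h]

theorem desc_root (T : G.Rooting root) (v : V) : T.Desc v root := by
  induction hn : G.height root v using Nat.strong_induction_on generalizing v with
  | _ n ih =>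
    by_cases hv : v = root
    · rw [hv]
      exact Relation.ReflTransGen.refl
    · have h1 := T.height_par hv
      exact Relation.ReflTransGen.head ⟨hv, rfl⟩ (ih _ (by omega) _ rfl)

/-- The climb from `v` to the root either enters `e` from below, at a vertex whose parent edge is
`e`, or never uses `e`. -/
theorem desc_or_linked (T : G.Rooting root) (e : Finset V) (v : V) :
    (∃ q ∈ e, q ≠ T.top e ∧ T.Desc v q) ∨
      G.Linked (fun c => G.height root (T.top c) < G.height root v ∧ c ≠ e) v root := by
  induction hn : G.height root v using Nat.strong_induction_on generalizing v with
  | _ n ih =>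
    by_cases hv : v = root
    · refine .inr ?_
      rw [hv]
      exact Linked.refl _
    · have h1 := T.height_par hv
      by_cases hpe : T.par v = e
      · exact .inl ⟨v, hpe ▸ T.mem_par v hv, hpe ▸ T.ne_top_par v hv, Relation.ReflTransGen.refl⟩
      · rcases ih _ (by omega) (T.top (T.par v)) rfl with ⟨q, hq, hqt, hd⟩ | h2
        · exact .inl ⟨q, hq, hqt, Relation.ReflTransGen.head ⟨hv, rfl⟩ hd⟩
        · refine .inr ((linked_of_mem (T.par_mem v hv) ⟨by omega, hpe⟩ (T.mem_par v hv)
            (T.top_par_mem hv)).trans (h2.mono ?_))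
          rintro c - ⟨h3, h4⟩
          exact ⟨by omega, h4⟩

/-- Two edges are either comparable or joined by a path between their top vertices. -/
theorem desc_or_linked_top (T : G.Rooting root) {e₁ e₂ : Finset V}
    (h : G.height root (T.top e₂) ≤ G.height root (T.top e₁)) :
    (∃ q ∈ e₂, q ≠ T.top e₂ ∧ T.Desc (T.top e₁) q) ∨
      G.Linked (fun c => c ≠ e₁ ∧ c ≠ e₂) (T.top e₁) (T.top e₂) := by
  rcases T.desc_or_linked e₂ (T.top e₁) with h1 | h1
  · exact .inl h1
  · refine .inr ((h1.mono ?_).trans (Linked.symm ?_))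
    · rintro c - ⟨h2, h3⟩
      exact ⟨fun h4 => by subst h4; omega, h3⟩
    · refine (T.desc_root (T.top e₂)).linked.mono ?_
      rintro c - ⟨-, h4⟩
      exact ⟨fun h5 => by subst h5; omega, fun h5 => by subst h5; omega⟩

/-- The path from a descendant edge `e₁` of `e₂` up to a lower vertex of `e₂`. -/
theorem Desc.linked_ne {T : G.Rooting root} {e₁ e₂ : Finset V} (he₂ : e₂ ∈ G.edges) {q : V}
    (hq : q ∈ e₂) (hqt : q ≠ T.top e₂) (hd : T.Desc (T.top e₁) q) :
    e₁ ≠ e₂ ∧ G.Linked (fun c => c ≠ e₁ ∧ c ≠ e₂) (T.top e₁) q := by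
  have h1 := T.height_eq e₂ he₂ q hq hqt
  have h2 := hd.height_le
  refine ⟨fun h => by subst h; omega, hd.linked.mono ?_⟩
  rintro c - ⟨h3, h4⟩
  exact ⟨fun h => by subst h; omega, fun h => by subst h; omega⟩

end Rooting

end FinHypergraph

/-! ### Energy, Rayleigh quotient and ground states -/

namespace FinHypergraph

variable {V : Type u} [Fintype V] [DecidableEq V]

/-- The Laplacian of a `k`-uniform hypergraph, multiplied by `k - 1`. -/
noncomputable def lapSum (G : FinHypergraph V) (k : ℕ) (f : V → ℝ) (v : V) : ℝ :=
  ∑ e ∈ G.edges.filter (fun e => v ∈ e), (k * f v - ∑ x ∈ e, f x)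

/-- The quadratic form of `lapSum` on a single edge. -/
noncomputable def edgeEnergy (k : ℕ) (f : V → ℝ) (e : Finset V) : ℝ :=
  k * ∑ x ∈ e, f x ^ 2 - (∑ x ∈ e, f x) ^ 2

/-- The quadratic form of `lapSum`. -/
noncomputable def energy (G : FinHypergraph V) (k : ℕ) (f : V → ℝ) : ℝ :=
  ∑ e ∈ G.edges, edgeEnergy k f e

theorem lapMatrix_mulVec {G : FinHypergraph V} {k : ℕ} (hk : 2 ≤ k) (hG : G.IsUniform k)
    (f : V → ℝ) (v : V) : ((k : ℝ) - 1) * G.lapMatrix.mulVec f v = G.lapSum k f v := by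
  have hk' : (k : ℝ) - 1 ≠ 0 := by
    have : (2 : ℝ) ≤ k := by exact_mod_cast hk
    linarith
  have h1 : G.adjMatrix.mulVec f v =
      ∑ e ∈ G.edges.filter (fun e => v ∈ e), (1 / ((k : ℝ) - 1)) * (∑ x ∈ e, f x - f v) := by
    have h2 : ∀ e ∈ G.edges.filter (fun e => v ∈ e),
        (1 / ((k : ℝ) - 1)) * (∑ x ∈ e, f x - f v) =
          ∑ j, if j ∈ e.erase v then 1 / ((e.card : ℝ) - 1) * f j else 0 := by
      intro e he
      obtain ⟨he, hv⟩ := Finset.mem_filter.1 he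
      rw [Finset.sum_ite_mem, Finset.univ_inter, ← Finset.mul_sum, hG e he,
        ← Finset.sum_erase_add e f hv, add_sub_cancel_right]
    rw [Finset.sum_congr rfl h2, Finset.sum_comm]
    refine Finset.sum_congr rfl fun j _ => ?_
    simp only [adjMatrix, Matrix.of_apply]
    split_ifs with hvj
    · subst hvj
      simp
    · rw [Finset.sum_mul, ← Finset.sum_filter, Finset.filter_filter]
      refine Finset.sum_congr ?_ fun _ _ => rfl
      ext e
      simp [Ne.symm hvj]
  rw [lapMatrix, Matrix.sub_mulVec, Pi.sub_apply, Matrix.mulVec_diagonal, h1, lapSum,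
    ← Finset.mul_sum, mul_sub, ← mul_assoc _ (1 / _), mul_one_div_cancel hk', one_mul,
    Finset.sum_sub_distrib, Finset.sum_sub_distrib, Finset.sum_const, Finset.sum_const, degree]
  simp only [nsmul_eq_mul]
  ring

theorem sum_mul_lapSum (G : FinHypergraph V) (k : ℕ) (f g : V → ℝ) :
    ∑ v, g v * G.lapSum k f v =
      ∑ e ∈ G.edges, (k * ∑ x ∈ e, f x * g x - (∑ x ∈ e, f x) * ∑ x ∈ e, g x) := by
  simp only [lapSum, Finset.mul_sum, Finset.sum_filter]
  rw [Finset.sum_comm]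
  refine Finset.sum_congr rfl fun e _ => ?_
  rw [← Finset.mul_sum, ← Finset.mul_sum, Finset.mul_sum, Finset.mul_sum,
    ← Finset.sum_sub_distrib]
  have h : ∀ v, (g v * if v ∈ e then (k * f v - ∑ x ∈ e, f x) else 0) =
      if v ∈ e then (k * (f v * g v) - (∑ x ∈ e, f x) * g v) else 0 := by
    intro v
    split_ifs <;> ring
  simp only [h]
  rw [Finset.sum_ite_mem, Finset.univ_inter]

theorem sum_mul_lapSum_self (G : FinHypergraph V) (k : ℕ) (f : V → ℝ) :
    ∑ v, f v * G.lapSum k f v = G.energy k f := by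
  rw [sum_mul_lapSum]
  simp only [energy, edgeEnergy, sq]

/-- The coefficient of `2 t` is the Laplacian at `v`, so minimality in the direction of `v` becomes
the eigenvalue equation at `v`. -/
theorem energy_add_single (G : FinHypergraph V) (k : ℕ) (f : V → ℝ) (v : V) (t : ℝ) :
    G.energy k (f + t • Pi.single v 1) =
      G.energy k f + 2 * t * G.lapSum k f v + t ^ 2 * G.energy k (Pi.single v 1) := by
  have h1 : G.lapSum k f v = ∑ w, (Pi.single v (1 : ℝ) : V → ℝ) w * G.lapSum k f w := by
    simp [Pi.single_apply]
  rw [h1, sum_mul_lapSum]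
  simp only [energy, Finset.mul_sum, ← Finset.sum_add_distrib]
  refine Finset.sum_congr rfl fun e _ => ?_
  generalize (Pi.single v (1 : ℝ) : V → ℝ) = s
  simp only [edgeEnergy, Pi.add_apply, Pi.smul_apply, smul_eq_mul, add_sq, mul_pow,
    Finset.sum_add_distrib, ← Finset.mul_sum, mul_assoc]
  have h2 : ∑ x ∈ e, f x * (t * s x) = t * ∑ x ∈ e, f x * s x := by
    rw [Finset.mul_sum]
    exact Finset.sum_congr rfl fun _ _ => by ring
  rw [h2]
  ring

/-- A function at which the Rayleigh quotient is minimal satisfies the eigenvalue equation. -/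
theorem lapSum_eq_of_isMin {G : FinHypergraph V} {k : ℕ} {m : ℝ} {f : V → ℝ}
    (hm : ∀ g : V → ℝ, (∀ v, G.IsBoundary v → g v = 0) → m * ∑ v, g v ^ 2 ≤ G.energy k g)
    (hf0 : ∀ v, G.IsBoundary v → f v = 0) (hf : G.energy k f ≤ m * ∑ v, f v ^ 2) {v : V}
    (hv : ¬ G.IsBoundary v) : G.lapSum k f v = m * f v := by
  -- A nonnegative quadratic polynomial in `t` without constant term has no linear term.
  have hquad : ∀ t : ℝ, 0 ≤ (G.energy k (Pi.single v 1) - m) * (t * t) +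
      (2 * (G.lapSum k f v - m * f v)) * t + 0 := by
    intro t
    have h1 := hm (f + t • Pi.single v 1) (fun w hw => by
      have : w ≠ v := fun h => hv (h ▸ hw)
      simp [hf0 w hw, this])
    have h2 : ∑ w, (f + t • Pi.single v (1 : ℝ) : V → ℝ) w ^ 2 =
        ∑ w, f w ^ 2 + 2 * t * f v + t ^ 2 := by
      have h3 : ∀ w, (f + t • Pi.single v (1 : ℝ) : V → ℝ) w ^ 2 =
          f w ^ 2 + if w = v then 2 * t * f w + t ^ 2 else 0 := by
        intro w
        by_cases hw : w = v
        · simp [hw]; ring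
        · simp [hw]
      simp only [h3, Finset.sum_add_distrib, Finset.sum_ite_eq', Finset.mem_univ, if_true]
      ring
    rw [energy_add_single, h2] at h1
    nlinarith
  have h := discrim_le_zero hquad
  simp only [discrim, mul_zero, sub_zero] at h
  have h' : 2 * (G.lapSum k f v - m * f v) = 0 := by
    have := sq_nonneg (2 * (G.lapSum k f v - m * f v))
    exact pow_eq_zero_iff (two_ne_zero) |>.1 (le_antisymm h this)
  linarith

/-- A minimizer of the Rayleigh quotient. -/
theorem exists_isMin_energy (G : FinHypergraph V) (k : ℕ) (hG : ∃ v, ¬ G.IsBoundary v) :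
    ∃ f : V → ℝ, (∀ v, G.IsBoundary v → f v = 0) ∧ ∑ v, f v ^ 2 = 1 ∧
      ∀ g : V → ℝ, (∀ v, G.IsBoundary v → g v = 0) →
        G.energy k f * ∑ v, g v ^ 2 ≤ G.energy k g := by
  let K : Set (V → ℝ) := {f | (∀ v, G.IsBoundary v → f v = 0) ∧ ∑ v, f v ^ 2 = 1}
  have hclosed : IsClosed K := by
    have h1 : IsClosed (⋂ (v : V) (_ : G.IsBoundary v), {f : V → ℝ | f v = 0}) :=
      isClosed_iInter fun v => isClosed_iInter fun _ =>
        isClosed_eq (continuous_apply v) continuous_const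
    have h2 : IsClosed {f : V → ℝ | ∑ v, f v ^ 2 = 1} :=
      isClosed_eq (by fun_prop) continuous_const
    have hK : K = (⋂ (v : V) (_ : G.IsBoundary v), {f : V → ℝ | f v = 0}) ∩
        {f : V → ℝ | ∑ v, f v ^ 2 = 1} := by
      ext f
      simp [K]
    rw [hK]
    exact h1.inter h2
  have hbdd : Bornology.IsBounded K := by
    refine (Metric.isBounded_closedBall (x := (0 : V → ℝ)) (r := 1)).subset ?_
    rintro f ⟨-, hf⟩
    rw [mem_closedBall_zero_iff, pi_norm_le_iff_of_nonneg zero_le_one]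
    intro v
    have : f v ^ 2 ≤ 1 := hf ▸ Finset.single_le_sum (f := fun v => f v ^ 2)
      (fun i _ => sq_nonneg (f i)) (Finset.mem_univ v)
    rw [Real.norm_eq_abs]
    exact abs_le_one_iff_mul_self_le_one.2 (by nlinarith)
  have hne : K.Nonempty := by
    obtain ⟨v, hv⟩ := hG
    refine ⟨Pi.single v 1, fun w hw => ?_, ?_⟩
    · have : w ≠ v := fun h => hv (h ▸ hw)
      simp [this]
    · simp [Pi.single_apply]
  have hcont : Continuous fun f : V → ℝ => G.energy k f := by
    unfold energy edgeEnergy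
    fun_prop
  obtain ⟨f, ⟨hf0, hf1⟩, hmin⟩ := (Metric.isCompact_of_isClosed_isBounded hclosed
    hbdd).exists_isMinOn hne hcont.continuousOn
  refine ⟨f, hf0, hf1, fun g hg => ?_⟩
  have hnn : 0 ≤ ∑ v, g v ^ 2 := Finset.sum_nonneg fun _ _ => sq_nonneg _
  rcases hnn.eq_or_lt with h0 | hpos
  · have hg0 : g = 0 := by
      funext v
      have := (Finset.sum_eq_zero_iff_of_nonneg (fun i _ => sq_nonneg (g i))).1 h0.symm v
        (Finset.mem_univ v)
      simpa using this
    subst hg0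
    simp [energy, edgeEnergy]
  -- The minimum over the unit sphere bounds the quotient of every `g ≠ 0`, because energy and
  -- squared norm are both homogeneous of degree two.
  · set s := √(∑ v, g v ^ 2) with hs
    have hs0 : 0 < s := Real.sqrt_pos.2 hpos
    have hs2 : s ^ 2 = ∑ v, g v ^ 2 := Real.sq_sqrt hnn
    have hscale : ∀ c : ℝ, G.energy k (fun v => c * g v) = c ^ 2 * G.energy k g := by
      intro c
      simp only [energy, edgeEnergy, Finset.mul_sum, mul_pow]
      refine Finset.sum_congr rfl fun e _ => ?_
      simp only [← Finset.mul_sum]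
      ring
    have h1 := hmin (a := fun v => s⁻¹ * g v) ⟨fun v hv => by simp [hg v hv], by
      simp only [mul_pow, ← Finset.mul_sum, ← hs2]
      field_simp⟩
    simp only [Set.mem_ofPred_eq, hscale] at h1
    rw [← hs2]
    calc G.energy k f * s ^ 2 ≤ (s⁻¹ ^ 2 * G.energy k g) * s ^ 2 := by gcongr
      _ = G.energy k g := by field_simp

/-- The variational characterization of the first Dirichlet eigenvalue. -/
theorem firstDirichletEigenvalue_eq {G : FinHypergraph V} {k : ℕ} (hk : 2 ≤ k)
    (hG : G.IsUniform k) {f : V → ℝ} (hf0 : ∀ v, G.IsBoundary v → f v = 0)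
    (hf1 : ∑ v, f v ^ 2 = 1)
    (hmin : ∀ g : V → ℝ, (∀ v, G.IsBoundary v → g v = 0) →
      G.energy k f * ∑ v, g v ^ 2 ≤ G.energy k g) :
    ((k : ℝ) - 1) * G.firstDirichletEigenvalue = G.energy k f := by
  have hk' : (0 : ℝ) < (k : ℝ) - 1 := by
    have : (2 : ℝ) ≤ k := by exact_mod_cast hk
    linarith
  have hleast : IsLeast {μ : ℝ | G.IsDirichletEigenvalue μ} (G.energy k f / ((k : ℝ) - 1)) := by
    constructor
    · refine ⟨f, ?_, fun v hv => ?_, hf0⟩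
      · rintro rfl
        simp at hf1
      · have h1 := lapSum_eq_of_isMin hmin hf0 (by rw [hf1, mul_one]) hv
        rw [← lapMatrix_mulVec hk hG] at h1
        field_simp
        linarith
    · rintro μ ⟨g, hg, heq, hg0⟩
      have h1 := hmin g hg0
      have hpos : 0 < ∑ v, g v ^ 2 := by
        obtain ⟨v, hv⟩ := Function.ne_iff.1 hg
        exact Finset.sum_pos' (fun i _ => sq_nonneg (g i)) ⟨v, Finset.mem_univ v, by
          have : g v ≠ 0 := hv
          positivity⟩
      have h2 : G.energy k g = ((k : ℝ) - 1) * μ * ∑ v, g v ^ 2 := by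
        rw [← sum_mul_lapSum_self, Finset.mul_sum]
        refine Finset.sum_congr rfl fun v _ => ?_
        by_cases hv : G.IsBoundary v
        · simp [hg0 v hv]
        · rw [← lapMatrix_mulVec hk hG, heq v hv]
          ring
      rw [h2] at h1
      rw [div_le_iff₀ hk']
      have := le_of_mul_le_mul_right h1 hpos
      linarith
  rw [firstDirichletEigenvalue, hleast.csInf_eq]
  field_simp

/-- This Rayleigh bound is later applied to the ground state of one supertree as a test function on
another. -/
theorem firstDirichletEigenvalue_mul_le {G : FinHypergraph V} {k : ℕ} (hk : 2 ≤ k)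
    (hG : G.IsUniform k) (hint : ∃ v, ¬ G.IsBoundary v) {g : V → ℝ}
    (hg : ∀ v, G.IsBoundary v → g v = 0) :
    ((k : ℝ) - 1) * G.firstDirichletEigenvalue * ∑ v, g v ^ 2 ≤ G.energy k g := by
  obtain ⟨f, hf0, hf1, hmin⟩ := exists_isMin_energy G k hint
  rw [firstDirichletEigenvalue_eq hk hG hf0 hf1 hmin]
  exact hmin g hg

/-- A positive Dirichlet eigenfunction for the first eigenvalue. -/
structure IsGroundState (G : FinHypergraph V) (k : ℕ) (f : V → ℝ) : Prop where
  zero : ∀ v, G.IsBoundary v → f v = 0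
  pos : ∀ v, ¬ G.IsBoundary v → 0 < f v
  eq : ∀ v, ¬ G.IsBoundary v →
    G.lapSum k f v = ((k : ℝ) - 1) * G.firstDirichletEigenvalue * f v

theorem IsGroundState.nonneg {G : FinHypergraph V} {k : ℕ} {f : V → ℝ}
    (hf : G.IsGroundState k f) (v : V) : 0 ≤ f v := by
  by_cases hv : G.IsBoundary v
  · exact (hf.zero v hv).ge
  · exact (hf.pos v hv).le

theorem IsGroundState.not_isBoundary {G : FinHypergraph V} {k : ℕ} {f : V → ℝ}
    (hf : G.IsGroundState k f) {v : V} (hv : 0 < f v) : ¬ G.IsBoundary v :=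
  fun h => hv.ne' (hf.zero v h)

theorem IsGroundState.energy_eq {G : FinHypergraph V} {k : ℕ} {f : V → ℝ}
    (hf : G.IsGroundState k f) :
    G.energy k f = ((k : ℝ) - 1) * G.firstDirichletEigenvalue * ∑ v, f v ^ 2 := by
  rw [← sum_mul_lapSum_self, Finset.mul_sum]
  refine Finset.sum_congr rfl fun v _ => ?_
  by_cases hv : G.IsBoundary v
  · simp [hf.zero v hv]
  · rw [hf.eq v hv]
    ring

/-- Replacing a minimizer by its absolute value does not raise the energy, since only `(∑ f)²`
changes and it grows. At an interior zero of a nonnegative minimizer the eigenvalue equation makes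
all neighbours vanish, so by connectedness a zero would spread everywhere. -/
theorem exists_groundState {G : FinHypergraph V} {k : ℕ} (hk : 2 ≤ k) (hG : G.IsUniform k)
    (hc : G.adjGraph.Connected) (hint : ∃ v, ¬ G.IsBoundary v) :
    ∃ f : V → ℝ, G.IsGroundState k f := by
  obtain ⟨f, hf0, hf1, hmin⟩ := exists_isMin_energy G k hint
  have hval := firstDirichletEigenvalue_eq hk hG hf0 hf1 hmin
  set g : V → ℝ := fun v => |f v| with hg
  have hg0 : ∀ v, G.IsBoundary v → g v = 0 := fun v hv => by simp [hg, hf0 v hv]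
  have hg1 : ∑ v, g v ^ 2 = 1 := by simp only [hg, sq_abs, hf1]
  have hge : G.energy k g ≤ G.energy k f := by
    refine Finset.sum_le_sum fun e _ => ?_
    simp only [edgeEnergy, hg, sq_abs]
    have : (∑ x ∈ e, f x) ^ 2 ≤ (∑ x ∈ e, |f x|) ^ 2 :=
      sq_le_sq' (by
        have := Finset.abs_sum_le_sum_abs f e
        have := neg_abs_le (∑ x ∈ e, f x)
        linarith) (Finset.sum_le_sum fun _ _ => le_abs_self _)
    linarith
  have heq : ∀ v, ¬ G.IsBoundary v → G.lapSum k g v = G.energy k f * g v := fun v hv =>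
    lapSum_eq_of_isMin hmin hg0 (by rw [hg1, mul_one]; exact hge) hv
  have hnn : ∀ v, 0 ≤ g v := fun v => abs_nonneg _
  refine ⟨g, hg0, fun v hv => ?_, fun v hv => by rw [hval]; exact heq v hv⟩
  by_contra hneg
  have hv0 : g v = 0 := le_antisymm (not_lt.1 hneg) (hnn v)
  have hnb : ∀ w, ¬ G.IsBoundary w → g w = 0 → ∀ e ∈ G.edges, w ∈ e → ∀ x ∈ e, g x = 0 := by
    intro w hw hw0 e he hwe
    have h1 := heq w hw
    simp only [lapSum, hw0, mul_zero, zero_sub, Finset.sum_neg_distrib, neg_eq_zero] at h1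
    have h2 := (Finset.sum_eq_zero_iff_of_nonneg
      (fun e _ => Finset.sum_nonneg fun x _ => hnn x)).1 h1 e (Finset.mem_filter.2 ⟨he, hwe⟩)
    exact (Finset.sum_eq_zero_iff_of_nonneg (fun x _ => hnn x)).1 h2
  have hall : ∀ w, g w = 0 ∧ ∀ e ∈ G.edges, w ∈ e → ∀ x ∈ e, g x = 0 := by
    intro w
    obtain ⟨p⟩ := (hc.preconnected v w).symm
    clear hneg
    induction p with
    | nil => exact ⟨hv0, hnb _ hv hv0⟩
    | cons hadj p ih =>
      obtain ⟨-, e, he, hx, hy⟩ := hadj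
      have h1 := (ih hv hv0).2 e he hy
      refine ⟨h1 _ hx, ?_⟩
      rename_i a b c
      -- A boundary vertex has no equation, but its only edge is the one through which the zero
      -- arrived.
      by_cases ha : G.IsBoundary a
      · intro e' he' hae'
        rw [eq_of_isBoundary ha he' he hae' hx]
        exact h1
      · exact hnb a ha (h1 _ hx)
  have : ∑ v, g v ^ 2 = 0 := Finset.sum_eq_zero fun v _ => by simp [(hall v).1]
  rw [hg1] at this
  exact one_ne_zero this

end FinHypergraph

namespace FinHypergraph

variable {V : Type u} [Fintype V] [DecidableEq V]

/-! ### Moving edges within the class -/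

section MapEdges

/-- The hypergraph obtained by replacing every edge `e` by `φ e`. -/
def mapEdges (G : FinHypergraph V) (φ : Finset V → Finset V)
    (hφ : ∀ e ∈ G.edges, (φ e).Nonempty) : FinHypergraph V where
  edges := G.edges.image φ
  nonempty_of_mem e he := by
    obtain ⟨c, hc, rfl⟩ := Finset.mem_image.1 he
    exact hφ c hc

/-- If the edges of a uniform supertree are replaced by sets that are not larger and the result is
connected, then it is again a uniform supertree with the same number of edges. -/
theorem mapEdges_isSupertree {G : FinHypergraph V} {k : ℕ} (hk : 2 ≤ k) (hG : G.IsUniform k)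
    (hT : G.IsSupertree) {φ : Finset V → Finset V} (hφ : ∀ e ∈ G.edges, (φ e).Nonempty)
    (hcard : ∀ e ∈ G.edges, (φ e).card ≤ k) (hc : (G.mapEdges φ hφ).adjGraph.Connected) :
    Set.InjOn φ G.edges ∧ (G.mapEdges φ hφ).IsUniform k ∧ (G.mapEdges φ hφ).IsSupertree := by
  -- Connectedness gives `|V| ≤ ∑ (|e| - 1) + 1` over the new edges, which is at most `|E| (k - 1) +
  -- 1 = |V|`. Equality throughout means that no two edges merge, every new edge has `k` vertices,
  -- and there is no cycle.
  have h1 := card_le_of_connected hc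
  have h2 := hT.card_eq
  have h3 : ∑ e ∈ G.edges, (e.card - 1) = G.edges.card * (k - 1) := by
    rw [Finset.sum_congr rfl fun e he => by rw [hG e he], Finset.sum_const, smul_eq_mul]
  have hle : ∀ e ∈ (G.mapEdges φ hφ).edges, e.card - 1 ≤ k - 1 := by
    intro e he
    obtain ⟨c, hc, rfl⟩ := Finset.mem_image.1 he
    have := hcard c hc
    omega
  have h4 : ∑ e ∈ (G.mapEdges φ hφ).edges, (e.card - 1) ≤
      (G.mapEdges φ hφ).edges.card * (k - 1) := by
    refine (Finset.sum_le_sum hle).trans ?_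
    rw [Finset.sum_const, smul_eq_mul]
  have h5 : (G.mapEdges φ hφ).edges.card ≤ G.edges.card := Finset.card_image_le
  have h6 := Nat.mul_le_mul_right (k - 1) h5
  have h7 : (G.mapEdges φ hφ).edges.card * (k - 1) = G.edges.card * (k - 1) := by omega
  have h8 : (G.mapEdges φ hφ).edges.card = G.edges.card :=
    Nat.eq_of_mul_eq_mul_right (by omega) h7
  have h9 : ∑ e ∈ (G.mapEdges φ hφ).edges, (e.card - 1) =
      ∑ e ∈ (G.mapEdges φ hφ).edges, (k - 1) := by
    rw [Finset.sum_const, smul_eq_mul]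
    omega
  have h10 := (Finset.sum_eq_sum_iff_of_le hle).1 h9
  refine ⟨Finset.card_image_iff.1 h8, fun e he => ?_, isSupertree_of_card_eq hc (by omega)⟩
  have := h10 e he
  have := Finset.card_pos.2 ((G.mapEdges φ hφ).nonempty_of_mem e he)
  omega

theorem degree_eq_sum (G : FinHypergraph V) (v : V) :
    G.degree v = ∑ e ∈ G.edges, if v ∈ e then 1 else 0 := by
  rw [degree, Finset.card_filter]

theorem lapSum_eq_sum (G : FinHypergraph V) (k : ℕ) (f : V → ℝ) (v : V) :
    G.lapSum k f v = ∑ e ∈ G.edges, if v ∈ e then k * f v - ∑ x ∈ e, f x else 0 := by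
  rw [lapSum, Finset.sum_filter]

theorem sum_mapEdges {M : Type*} [AddCommMonoid M] {G : FinHypergraph V} {φ : Finset V → Finset V}
    (hφ : ∀ e ∈ G.edges, (φ e).Nonempty) (hinj : Set.InjOn φ G.edges) (F : Finset V → M) :
    ∑ e ∈ (G.mapEdges φ hφ).edges, F e = ∑ e ∈ G.edges, F (φ e) :=
  Finset.sum_image hinj

end MapEdges

section Compare

variable {G : FinHypergraph V} {k : ℕ} {π : Multiset ℕ} {f : V → ℝ}

/-- If moving edges does not increase the energy of the ground state of a Faber–Krahn supertree,
then it preserves the energy and the eigenvalue equation. -/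
theorem IsGroundState.compare (hk : 2 ≤ k) (hFK : G.HasFaberKrahn k π)
    (hf : G.IsGroundState k f) {H : FinHypergraph V} (hH : H.MemClass k π)
    (hb : ∀ v, H.IsBoundary v ↔ G.IsBoundary v) (hint : ∃ v, ¬ G.IsBoundary v)
    (hE : H.energy k f ≤ G.energy k f) :
    H.energy k f = G.energy k f ∧
      ∀ v, ¬ G.IsBoundary v → H.lapSum k f v = G.lapSum k f v := by
  have hk' : (0 : ℝ) < (k : ℝ) - 1 := by
    have : (2 : ℝ) ≤ k := by exact_mod_cast hk
    linarith
  have hintH : ∃ v, ¬ H.IsBoundary v := hint.imp fun v hv h => hv ((hb v).1 h)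
  have h0 : ∀ v, H.IsBoundary v → f v = 0 := fun v hv => hf.zero v ((hb v).1 hv)
  have h1 := hFK.2 V H hH
  have h2 := firstDirichletEigenvalue_mul_le hk hH.isUniform hintH h0
  have h3 := hf.energy_eq
  have hpos : 0 < ∑ v, f v ^ 2 := by
    obtain ⟨v, hv⟩ := hint
    have := hf.pos v hv
    exact Finset.sum_pos' (fun i _ => sq_nonneg (f i)) ⟨v, Finset.mem_univ v, by positivity⟩
  have h4 : ((k : ℝ) - 1) * G.firstDirichletEigenvalue ≤
      ((k : ℝ) - 1) * H.firstDirichletEigenvalue := by gcongr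
  have h5 := mul_le_mul_of_nonneg_right h4 hpos.le
  -- The chain `λ(H) ∑ f² ≤ λ(G) ∑ f² ≤ λ(H) ∑ f²`, up to the factor `k - 1`, closes up, so `f` also
  -- minimizes the quotient of `H`.
  have h6 : ((k : ℝ) - 1) * H.firstDirichletEigenvalue =
      ((k : ℝ) - 1) * G.firstDirichletEigenvalue :=
    mul_right_cancel₀ hpos.ne' (le_antisymm (by linarith) h5)
  refine ⟨by linarith, fun v hv => ?_⟩
  rw [hf.eq v hv, ← h6]
  exact lapSum_eq_of_isMin (m := ((k : ℝ) - 1) * H.firstDirichletEigenvalue)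
    (fun g hg => firstDirichletEigenvalue_mul_le hk hH.isUniform hintH hg) h0 (by linarith)
    (fun h => hv ((hb v).1 h))

end Compare

/-! ### Exchanging two vertices between two edges -/

section Swap

/-- Exchanging `a ∈ e₁` with `b ∈ e₂` preserves connectedness. -/
structure Swappable (G : FinHypergraph V) (e₁ e₂ : Finset V) (a b : V) : Prop where
  left_mem : e₁ ∈ G.edges
  right_mem : e₂ ∈ G.edges
  ne : e₁ ≠ e₂
  mem_left : a ∈ e₁
  mem_right : b ∈ e₂
  vertex_ne : a ≠ b
  connected : ∀ H : FinHypergraph V, (∀ e ∈ G.edges, e ≠ e₁ → e ≠ e₂ → e ∈ H.edges) →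
    insert b (e₁.erase a) ∈ H.edges → insert a (e₂.erase b) ∈ H.edges → H.adjGraph.Connected

variable {G : FinHypergraph V} {k : ℕ} {π : Multiset ℕ} {f : V → ℝ} {e₁ e₂ : Finset V} {a b : V}

theorem Swappable.symm (h : G.Swappable e₁ e₂ a b) : G.Swappable e₂ e₁ b a where
  left_mem := h.right_mem
  right_mem := h.left_mem
  ne := h.ne.symm
  mem_left := h.mem_right
  mem_right := h.mem_left
  vertex_ne := h.vertex_ne.symm
  connected H h1 h2 h3 := h.connected H (fun e he h4 h5 => h1 e he h5 h4) h3 h2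

theorem connected_of_reachable {H : FinHypergraph V} (hG : G.adjGraph.Connected) (c : V)
    (hH : ∀ e ∈ G.edges, e ≠ e₁ → e ≠ e₂ → e ∈ H.edges)
    (h₁ : ∀ x ∈ e₁, H.adjGraph.Reachable x c) (h₂ : ∀ x ∈ e₂, H.adjGraph.Reachable x c) :
    H.adjGraph.Connected := by
  have := hG.nonempty
  refine ⟨fun u v => reachable_of_forall_edge ?_ (hG.preconnected u v)⟩
  intro e he x hx y hy
  by_cases h1 : e = e₁
  · subst h1
    exact (h₁ x hx).trans (h₁ y hy).symm
  by_cases h2 : e = e₂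
  · subst h2
    exact (h₂ x hx).trans (h₂ y hy).symm
  exact reachable_of_mem (hH e he h1 h2) hx hy

/-- The exchanged vertices are the ends of a path outside both edges. That path survives, so the
remainders of the edges merely trade the points at which they are attached. -/
theorem swappable_gates (hG : G.adjGraph.Connected) (he₁ : e₁ ∈ G.edges) (he₂ : e₂ ∈ G.edges)
    (hne : e₁ ≠ e₂) (ha : a ∈ e₁) (hb : b ∈ e₂) (hab : a ≠ b)
    (hl : G.Linked (fun c => c ≠ e₁ ∧ c ≠ e₂) a b) : G.Swappable e₁ e₂ a b := by
  refine ⟨he₁, he₂, hne, ha, hb, hab, fun H hH h1 h2 => ?_⟩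
  have hl' : H.adjGraph.Reachable a b := hl.reachable fun e he h => hH e he h.1 h.2
  refine connected_of_reachable hG a hH (fun x hx => ?_) fun x hx => ?_
  · by_cases hxa : x = a
    · rw [hxa]
    · exact (reachable_of_mem h1 (Finset.mem_insert_of_mem (Finset.mem_erase.2 ⟨hxa, hx⟩))
        (Finset.mem_insert_self _ _)).trans hl'.symm
  · by_cases hxb : x = b
    · rw [hxb]
      exact hl'.symm
    · exact reachable_of_mem h2 (Finset.mem_insert_of_mem (Finset.mem_erase.2 ⟨hxb, hx⟩))
        (Finset.mem_insert_self _ _)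

/-- The ends `g₁`, `g₂` of the connecting path stay in their edges, and the exchanged vertices
remain attached through them. A common vertex `a = b` would close a cycle with the path. -/
theorem swappable_of_linked (hG : G.IsSupertree) (he₁ : e₁ ∈ G.edges) (he₂ : e₂ ∈ G.edges)
    (hne : e₁ ≠ e₂) {g₁ g₂ : V} (hg₁ : g₁ ∈ e₁) (hg₂ : g₂ ∈ e₂)
    (hl : G.Linked (fun c => c ≠ e₁ ∧ c ≠ e₂) g₁ g₂) (ha : a ∈ e₁) (hb : b ∈ e₂)
    (hag : a ≠ g₁) (hbg : b ≠ g₂) : G.Swappable e₁ e₂ a b := by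
  refine ⟨he₁, he₂, hne, ha, hb, ?_, fun H hH h1 h2 => ?_⟩
  · rintro rfl
    refine hG.2 (hasCycle_of_linked he₁ ha hg₁ hag ?_)
    exact (linked_of_mem he₂ hne.symm hb hg₂).trans (hl.symm.mono fun e _ h => h.1)
  have hl' : H.adjGraph.Reachable g₁ g₂ := hl.reachable fun e he h => hH e he h.1 h.2
  have h1g := Finset.mem_insert_of_mem (a := g₁) (b := b) (Finset.mem_erase.2 ⟨hag.symm, hg₁⟩)
  have h2g := Finset.mem_insert_of_mem (a := g₂) (b := a) (Finset.mem_erase.2 ⟨hbg.symm, hg₂⟩)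
  refine connected_of_reachable hG.1 g₁ hH (fun x hx => ?_) fun x hx => ?_
  · by_cases hxa : x = a
    · rw [hxa]
      exact (reachable_of_mem h2 (Finset.mem_insert_self _ _) h2g).trans hl'.symm
    · exact reachable_of_mem h1 (Finset.mem_insert_of_mem (Finset.mem_erase.2 ⟨hxa, hx⟩)) h1g
  · by_cases hxb : x = b
    · rw [hxb]
      exact reachable_of_mem h1 (Finset.mem_insert_self _ _) h1g
    · exact (reachable_of_mem h2 (Finset.mem_insert_of_mem (Finset.mem_erase.2 ⟨hxb, hx⟩))
        h2g).trans hl'.symm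

theorem sum_insert_erase {M : Type*} [AddCommGroup M] {e : Finset V} {a b : V} (ha : a ∈ e)
    (hb : b ∉ e) (F : V → M) :
    ∑ x ∈ insert b (e.erase a), F x = ∑ x ∈ e, F x - F a + F b := by
  rw [Finset.sum_insert fun h => hb (Finset.mem_of_mem_erase h), Finset.sum_erase_eq_sub ha]
  abel

theorem notMem_of_card_insert_erase {e : Finset V} {a b : V} (ha : a ∈ e) (hab : a ≠ b)
    (h : (insert b (e.erase a)).card = e.card) : b ∉ e := by
  intro hb
  rw [Finset.insert_eq_of_mem (Finset.mem_erase.2 ⟨hab.symm, hb⟩),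
    Finset.card_erase_of_mem ha] at h
  have := Finset.card_pos.2 ⟨a, ha⟩
  omega

theorem card_insert_erase_le {e : Finset V} {a b : V} (ha : a ∈ e) :
    (insert b (e.erase a)).card ≤ e.card := by
  refine (Finset.card_insert_le _ _).trans ?_
  rw [Finset.card_erase_of_mem ha]
  have := Finset.card_pos.2 ⟨a, ha⟩
  omega

/-- The comparison of two edges of a Faber–Krahn supertree that results from exchanging two of
their vertices. -/
theorem Swappable.sum_le_and_eq (h : G.Swappable e₁ e₂ a b) (hk : 2 ≤ k)
    (hFK : G.HasFaberKrahn k π) (hf : G.IsGroundState k f) :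
    (f a < f b → ∑ x ∈ e₁, f x < ∑ x ∈ e₂, f x) ∧
      (f a = f b → 0 < f a → ∑ x ∈ e₁, f x = ∑ x ∈ e₂, f x) := by
  obtain ⟨hunif, hT, hdeg⟩ := hFK.1
  obtain ⟨he₁, he₂, hne, ha, hb, hab, hconn⟩ := h
  let φ : Finset V → Finset V := fun e =>
    if e = e₁ then insert b (e₁.erase a) else if e = e₂ then insert a (e₂.erase b) else e
  have hφ₁ : φ e₁ = insert b (e₁.erase a) := by simp [φ]
  have hφ₂ : φ e₂ = insert a (e₂.erase b) := by simp [φ, hne.symm]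
  have hφ : ∀ e, e ≠ e₁ → e ≠ e₂ → φ e = e := fun e h1 h2 => by simp [φ, h1, h2]
  have hφne : ∀ e ∈ G.edges, (φ e).Nonempty := by
    intro e he
    simp only [φ]
    split_ifs
    · exact Finset.insert_nonempty _ _
    · exact Finset.insert_nonempty _ _
    · exact G.nonempty_of_mem e he
  have hφcard : ∀ e ∈ G.edges, (φ e).card ≤ k := by
    intro e he
    simp only [φ]
    split_ifs
    · exact (card_insert_erase_le ha).trans (hunif _ he₁).le
    · exact (card_insert_erase_le hb).trans (hunif _ he₂).le
    · exact (hunif e he).le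
  set H := G.mapEdges φ hφne with hH
  have hmem : ∀ e ∈ G.edges, φ e ∈ H.edges := fun e he => Finset.mem_image_of_mem _ he
  have hHc : H.adjGraph.Connected := by
    refine hconn H (fun e he h1 h2 => ?_) ?_ ?_
    · rw [← hφ e h1 h2]
      exact hmem e he
    · rw [← hφ₁]
      exact hmem _ he₁
    · rw [← hφ₂]
      exact hmem _ he₂
  obtain ⟨hinj, hHu, hHT⟩ := mapEdges_isSupertree hk hunif hT hφne hφcard hHc
  -- The new edges still have `k` vertices, so the inserted vertex was not already present.
  have hb₁ : b ∉ e₁ := by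
    refine notMem_of_card_insert_erase ha hab ?_
    rw [hunif _ he₁, ← hφ₁]
    exact hHu _ (hmem _ he₁)
  have ha₂ : a ∉ e₂ := by
    refine notMem_of_card_insert_erase hb hab.symm ?_
    rw [hunif _ he₂, ← hφ₂]
    exact hHu _ (hmem _ he₂)
  have hsum : ∀ {M : Type} [AddCommGroup M] (F : Finset V → M),
      ∑ e ∈ H.edges, F e = ∑ e ∈ G.edges, F e - F e₁ - F e₂ + F (insert b (e₁.erase a)) +
        F (insert a (e₂.erase b)) := by
    intro M _ F
    rw [hH, sum_mapEdges hφne hinj]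
    have hm : e₂ ∈ G.edges.erase e₁ := Finset.mem_erase.2 ⟨hne.symm, he₂⟩
    rw [← Finset.add_sum_erase _ _ he₁, ← Finset.add_sum_erase _ _ hm,
      ← Finset.add_sum_erase _ (fun e => F e) he₁, ← Finset.add_sum_erase _ (fun e => F e) hm,
      hφ₁, hφ₂]
    have : ∑ e ∈ (G.edges.erase e₁).erase e₂, F (φ e) =
        ∑ e ∈ (G.edges.erase e₁).erase e₂, F e := by
      refine Finset.sum_congr rfl fun e he => ?_
      simp only [Finset.mem_erase] at he
      rw [hφ e he.2.1 he.1]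
    rw [this]
    abel
  have hdegree : ∀ v, H.degree v = G.degree v := by
    intro v
    have h1 : (H.degree v : ℤ) = G.degree v := by
      rw [degree_eq_sum, degree_eq_sum]
      push_cast
      rw [hsum]
      by_cases hva : v = a
      · subst hva
        simp [ha, ha₂, hab]
      · by_cases hvb : v = b
        · subst hvb
          simp [hb, hb₁, hva]
        · simp [hva, hvb]
          abel
    exact_mod_cast h1
  have hclass : H.MemClass k π := ⟨hHu, hHT, by
    rw [← hdeg, degreeSequence, degreeSequence]
    exact Multiset.map_congr rfl fun v _ => hdegree v⟩
  have hbd : ∀ v, H.IsBoundary v ↔ G.IsBoundary v := fun v => by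
    rw [IsBoundary, IsBoundary, hdegree]
  have hener : H.energy k f = G.energy k f -
      2 * (f b - f a) * ((∑ x ∈ e₁, f x - f a) - (∑ x ∈ e₂, f x - f b)) := by
    rw [energy, hsum, ← energy]
    simp only [edgeEnergy, sum_insert_erase ha hb₁, sum_insert_erase hb ha₂]
    ring
  constructor
  · intro hlt
    by_contra hge
    have hb0 : ¬ G.IsBoundary b := hf.not_isBoundary ((hf.nonneg a).trans_lt hlt)
    -- If `e₁` were at least as heavy, removing the smaller `f a` would leave more than `e₂` keeps
    -- without `f b`; the energy would drop strictly.
    have h1 : 0 < 2 * (f b - f a) * ((∑ x ∈ e₁, f x - f a) - (∑ x ∈ e₂, f x - f b)) := by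
      apply mul_pos <;> linarith
    have := (hf.compare hk hFK hclass hbd ⟨b, hb0⟩ (by linarith)).1
    linarith
  · intro heq hpos
    have ha0 : ¬ G.IsBoundary a := hf.not_isBoundary hpos
    -- The energy is unchanged, so the Laplacians agree at `a`. There the edge `e₁` has been
    -- replaced by `e₂` with `a` in place of `b`, and `f a = f b`.
    have h1 := (hf.compare hk hFK hclass hbd ⟨a, ha0⟩ (by rw [hener, heq]; simp)).2 a ha0
    rw [lapSum_eq_sum, lapSum_eq_sum, hsum] at h1
    simp only [ha, ha₂, if_true, if_false, Finset.mem_insert, hab, Finset.mem_erase, ne_eq,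
      not_true_eq_false, false_and, or_self, true_or, sum_insert_erase hb ha₂] at h1
    linarith

theorem Swappable.sum_lt (h : G.Swappable e₁ e₂ a b) (hk : 2 ≤ k) (hFK : G.HasFaberKrahn k π)
    (hf : G.IsGroundState k f) (hab : f a < f b) : ∑ x ∈ e₁, f x < ∑ x ∈ e₂, f x :=
  (h.sum_le_and_eq hk hFK hf).1 hab

theorem Swappable.sum_eq (h : G.Swappable e₁ e₂ a b) (hk : 2 ≤ k) (hFK : G.HasFaberKrahn k π)
    (hf : G.IsGroundState k f) (hab : f a = f b) (ha : 0 < f a) :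
    ∑ x ∈ e₁, f x = ∑ x ∈ e₂, f x :=
  (h.sum_le_and_eq hk hFK hf).2 hab ha

end Swap

end FinHypergraph

/-! ### Monotonicity of the ground state -/

namespace FinHypergraph

variable {V : Type u} [Fintype V] [DecidableEq V]

/-- `f` is the ground state of a Faber–Krahn supertree with an interior vertex, and is maximal at
`root`. -/
structure IsExtremal (G : FinHypergraph V) (k : ℕ) (π : Multiset ℕ) (f : V → ℝ) (root : V) :
    Prop where
  two_le : 2 ≤ k
  faberKrahn : G.HasFaberKrahn k π
  groundState : G.IsGroundState k f
  exists_interior : ∃ v, ¬ G.IsBoundary v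
  le_root : ∀ v, f v ≤ f root

theorem exists_ne_of_uniform {G : FinHypergraph V} {k : ℕ} (hk : 2 ≤ k) (hG : G.IsUniform k)
    {e : Finset V} (he : e ∈ G.edges) (t : V) : ∃ y ∈ e, y ≠ t := by
  have h1 : 1 < e.card := by rw [hG e he]; omega
  exact Finset.exists_mem_ne h1 t

theorem exists_edge_ne {G : FinHypergraph V} {y : V} (hy : ¬ G.IsBoundary y) {e : Finset V}
    (he : e ∈ G.edges) (hye : y ∈ e) : ∃ e' ∈ G.edges, y ∈ e' ∧ e' ≠ e := by
  have hmem : e ∈ G.edges.filter (fun e => y ∈ e) := Finset.mem_filter.2 ⟨he, hye⟩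
  have hpos : 0 < G.degree y := Finset.card_pos.2 ⟨e, hmem⟩
  have h1 : 1 < (G.edges.filter (fun e => y ∈ e)).card := by
    have : G.degree y ≠ 1 := hy
    rw [← degree]
    omega
  obtain ⟨e', he', hne⟩ := Finset.exists_mem_ne h1 e
  exact ⟨e', (Finset.mem_filter.1 he').1, (Finset.mem_filter.1 he').2, hne⟩

/-- An interior vertex below the top of an edge is the top of another edge. -/
theorem Rooting.exists_top_eq {G : FinHypergraph V} {root : V} (T : G.Rooting root) {y : V}
    (hy : ¬ G.IsBoundary y) {e : Finset V} (he : e ∈ G.edges) (hye : y ∈ e)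
    (hyt : y ≠ T.top e) : ∃ e' ∈ G.edges, T.top e' = y ∧ e' ≠ e := by
  obtain ⟨e', he', hye', hne⟩ := exists_edge_ne hy he hye
  refine ⟨e', he', ?_, hne⟩
  by_contra h
  exact hne ((T.par_eq e' he' y hye' (Ne.symm h)).symm.trans (T.par_eq e he y hye hyt))

namespace IsExtremal

variable {G : FinHypergraph V} {k : ℕ} {π : Multiset ℕ} {f : V → ℝ} {root : V}

theorem root_pos (h : G.IsExtremal k π f root) : 0 < f root := by
  obtain ⟨v, hv⟩ := h.exists_interior
  exact (h.groundState.pos v hv).trans_le (h.le_root v)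

/-- A top other than the root lies in a second edge, its parent edge, hence is interior. -/
theorem top_pos (h : G.IsExtremal k π f root) (T : G.Rooting root) {e : Finset V}
    (he : e ∈ G.edges) : 0 < f (T.top e) := by
  by_cases hr : T.top e = root
  · rw [hr]
    exact h.root_pos
  · refine h.groundState.pos _ fun hb => ?_
    have h1 := eq_of_isBoundary hb he (T.par_mem _ hr) (T.top_mem e he) (T.mem_par _ hr)
    exact T.ne_top_par _ hr (by rw [← h1])

/-- An edge has at least the weight of the edges below it. -/
theorem sum_le_of_desc (h : G.IsExtremal k π f root) (T : G.Rooting root) {e₁ e₂ : Finset V}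
    (he₁ : e₁ ∈ G.edges) (he₂ : e₂ ∈ G.edges) {q : V} (hq : q ∈ e₁) (hqt : q ≠ T.top e₁)
    (hd : T.Desc (T.top e₂) q) : ∑ x ∈ e₂, f x ≤ ∑ x ∈ e₁, f x := by
  induction hn : G.height root (T.top e₁) using Nat.strong_induction_on
    generalizing e₁ e₂ q with
  | _ n ih =>
    by_contra hlt
    rw [not_le] at hlt
    obtain ⟨y, hy, hyt⟩ := exists_ne_of_uniform h.two_le h.faberKrahn.1.isUniform he₂ (T.top e₂)
    obtain ⟨hne, hl⟩ := hd.linked_ne he₁ hq hqt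
    have hsw : G.Swappable e₂ e₁ y (T.top e₁) :=
      swappable_of_linked h.faberKrahn.1.isSupertree he₂ he₁ hne (T.top_mem _ he₂) hq hl hy
        (T.top_mem _ he₁) hyt hqt.symm
    -- Exchanging `y` and `top e₁` along the path from `top e₂` up to `q`: the two rules leave only
    -- this possibility when `e₂` is heavier.
    have hfy : f (T.top e₁) < f y := by
      rcases lt_trichotomy (f (T.top e₁)) (f y) with h1 | h1 | h1
      · exact h1
      · have := hsw.symm.sum_eq h.two_le h.faberKrahn h.groundState h1 (h.top_pos T he₁)
        linarith
      · have := hsw.sum_lt h.two_le h.faberKrahn h.groundState h1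
        linarith
    by_cases hr : T.top e₁ = root
    · have := h.le_root y
      rw [← hr] at this
      linarith
    · have hyb := h.groundState.not_isBoundary ((h.top_pos T he₁).trans hfy)
      -- Being interior, `y` carries an edge `e₄` below the parent edge of `top e₁`. The induction
      -- hypothesis makes `e₄` no heavier than that parent edge, whereas exchanging `y` and `top e₁`
      -- makes it strictly heavier.
      obtain ⟨e₄, he₄, hy₄, -⟩ := T.exists_top_eq hyb he₂ hy hyt
      have hd' : T.Desc (T.top e₄) (T.top e₁) := by
        rw [hy₄]
        exact ((T.desc_top he₂ hy).trans hd).trans (T.desc_top he₁ hq)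
      have hpar := T.par_mem _ hr
      have hh := T.height_par hr
      have h3 := ih _ (by omega) hpar he₄ (T.mem_par _ hr) (T.ne_top_par _ hr) hd' rfl
      obtain ⟨hne', hl'⟩ := hd'.linked_ne hpar (T.mem_par _ hr) (T.ne_top_par _ hr)
      have hsw' : G.Swappable e₄ (T.par (T.top e₁)) (T.top e₄) (T.top e₁) :=
        swappable_gates T.connected he₄ hpar hne' (T.top_mem _ he₄) (T.mem_par _ hr)
          (fun h4 => by rw [hy₄] at h4; rw [h4] at hfy; exact lt_irrefl _ hfy) hl'
      have := hsw'.symm.sum_lt h.two_le h.faberKrahn h.groundState (by rw [hy₄]; exact hfy)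
      linarith

/-- A vertex `y` exceeding `top e` would be interior and carry an edge of its own. Exchanging `y`
and `top e` would make that edge heavier than the parent edge of `top e`, against `sum_le_of_desc`.
-/
theorem le_top (h : G.IsExtremal k π f root) (T : G.Rooting root) {e : Finset V}
    (he : e ∈ G.edges) {y : V} (hy : y ∈ e) : f y ≤ f (T.top e) := by
  by_contra hlt
  rw [not_le] at hlt
  have hyt : y ≠ T.top e := fun h1 => by
    rw [← h1] at hlt
    exact lt_irrefl _ hlt
  have hr : T.top e ≠ root := fun h1 => by
    have := h.le_root y
    rw [← h1] at this
    linarith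
  have hyb := h.groundState.not_isBoundary ((h.top_pos T he).trans hlt)
  obtain ⟨e₄, he₄, hy₄, -⟩ := T.exists_top_eq hyb he hy hyt
  have hd : T.Desc (T.top e₄) (T.top e) := by
    rw [hy₄]
    exact T.desc_top he hy
  have hpar := T.par_mem _ hr
  have h3 := h.sum_le_of_desc T hpar he₄ (T.mem_par _ hr) (T.ne_top_par _ hr) hd
  obtain ⟨hne, hl⟩ := hd.linked_ne hpar (T.mem_par _ hr) (T.ne_top_par _ hr)
  have hsw : G.Swappable e₄ (T.par (T.top e)) (T.top e₄) (T.top e) :=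
    swappable_gates T.connected he₄ hpar hne (T.top_mem _ he₄) (T.mem_par _ hr)
      (by rw [hy₄]; exact hyt) hl
  have := hsw.symm.sum_lt h.two_le h.faberKrahn h.groundState (by rw [hy₄]; exact hlt)
  linarith

theorem le_of_desc (h : G.IsExtremal k π f root) {T : G.Rooting root} {v q : V}
    (hd : T.Desc v q) : f v ≤ f q := by
  induction hd with
  | refl => exact le_rfl
  | tail _ h1 ih =>
    obtain ⟨h2, rfl⟩ := h1
    exact ih.trans (h.le_top T (T.par_mem _ h2) (T.mem_par _ h2))

/-- Two edges with linked tops: the heavier edge dominates below the tops. -/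
theorem le_of_sum_le (h : G.IsExtremal k π f root) (T : G.Rooting root) {e₁ e₂ : Finset V}
    (he₁ : e₁ ∈ G.edges) (he₂ : e₂ ∈ G.edges) (hne : e₁ ≠ e₂)
    (hl : G.Linked (fun c => c ≠ e₁ ∧ c ≠ e₂) (T.top e₁) (T.top e₂))
    (hs : ∑ x ∈ e₂, f x ≤ ∑ x ∈ e₁, f x) {x y : V} (hx : x ∈ e₁) (hxt : x ≠ T.top e₁)
    (hy : y ∈ e₂) (hyt : y ≠ T.top e₂) : f y ≤ f x := by
  by_contra hlt
  rw [not_le] at hlt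
  have hsw : G.Swappable e₁ e₂ x y :=
    swappable_of_linked h.faberKrahn.1.isSupertree he₁ he₂ hne (T.top_mem _ he₁)
      (T.top_mem _ he₂) hl hx hy hxt hyt
  have := hsw.sum_lt h.two_le h.faberKrahn h.groundState hlt
  linarith

/-- Exchanging the tops compares the weights of the two edges; exchanging lower vertices then
compares these. -/
theorem le_of_top_le (h : G.IsExtremal k π f root) (T : G.Rooting root) {e₁ e₂ : Finset V}
    (he₁ : e₁ ∈ G.edges) (he₂ : e₂ ∈ G.edges) (htne : T.top e₁ ≠ T.top e₂)
    (hl : G.Linked (fun c => c ≠ e₁ ∧ c ≠ e₂) (T.top e₁) (T.top e₂))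
    (ht : f (T.top e₂) ≤ f (T.top e₁)) {x y : V} (hx : x ∈ e₁) (hxt : x ≠ T.top e₁)
    (hy : y ∈ e₂) (hyt : y ≠ T.top e₂) : f y ≤ f x := by
  have hne : e₁ ≠ e₂ := fun h1 => htne (by rw [h1])
  have hsw : G.Swappable e₁ e₂ (T.top e₁) (T.top e₂) :=
    swappable_gates T.connected he₁ he₂ hne (T.top_mem _ he₁) (T.top_mem _ he₂) htne hl
  refine h.le_of_sum_le T he₁ he₂ hne hl ?_ hx hxt hy hyt
  rcases ht.lt_or_eq with h1 | h1
  · exact (hsw.symm.sum_lt h.two_le h.faberKrahn h.groundState h1).le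
  · exact (hsw.symm.sum_eq h.two_le h.faberKrahn h.groundState h1 (h.top_pos T he₂)).le

/-- Induction through the parents, which also differ by one in height. Either the parent edge of `v`
lies below that of `u`, and its weight is controlled by `sum_le_of_desc`, or the tops are linked and
`le_of_top_le` applies. -/
theorem le_of_height_succ (h : G.IsExtremal k π f root) (T : G.Rooting root) {u v : V}
    (huv : G.height root v = G.height root u + 1) : f v ≤ f u := by
  induction hn : G.height root u using Nat.strong_induction_on generalizing u v with
  | _ n ih =>
    by_cases hu : u = root
    · rw [hu]
      exact h.le_root v
    have hv : v ≠ root := fun h1 => by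
      rw [h1, height_root] at huv
      omega
    have hhu := T.height_par hu
    have hhv := T.height_par hv
    have hT := ih (G.height root (T.top (T.par u))) (by omega)
      (u := T.top (T.par u)) (v := T.top (T.par v)) (by omega) rfl
    rcases T.desc_or_linked_top (e₁ := T.par v) (e₂ := T.par u) (by omega) with
      ⟨q, hq, hqt, hd⟩ | hl
    · by_cases huq : u = q
      · rw [huq]
        exact (h.le_top T (T.par_mem v hv) (T.mem_par v hv)).trans (h.le_of_desc hd)
      · have hs := h.sum_le_of_desc T (T.par_mem u hu) (T.par_mem v hv) hq hqt hd
        obtain ⟨hne, hl⟩ := hd.linked_ne (T.par_mem u hu) hq hqt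
        by_contra hlt
        rw [not_le] at hlt
        have hsw : G.Swappable (T.par v) (T.par u) v u :=
          swappable_of_linked h.faberKrahn.1.isSupertree (T.par_mem v hv) (T.par_mem u hu) hne
            (T.top_par_mem hv) hq hl (T.mem_par v hv) (T.mem_par u hu) (T.ne_top_par v hv) huq
        have := hsw.symm.sum_lt h.two_le h.faberKrahn h.groundState hlt
        linarith
    · refine h.le_of_top_le T (T.par_mem u hu) (T.par_mem v hv) ?_
        (hl.symm.mono fun _ _ h1 => h1.symm) hT (T.mem_par u hu) (T.ne_top_par u hu)
        (T.mem_par v hv) (T.ne_top_par v hv)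
      intro h1
      rw [h1] at hhu
      omega

/-- The ground state decreases with the height. -/
theorem le_of_height_lt (h : G.IsExtremal k π f root) (T : G.Rooting root) {u v : V}
    (huv : G.height root u < G.height root v) : f v ≤ f u := by
  induction hn : G.height root v using Nat.strong_induction_on generalizing v with
  | _ n ih =>
    rcases Nat.lt_or_ge (G.height root u + 1) (G.height root v) with h1 | h1
    · have hv : v ≠ root := fun h2 => by
        rw [h2, height_root] at huv
        omega
      have hhv := T.height_par hv
      exact (h.le_top T (T.par_mem v hv) (T.mem_par v hv)).trans
        (ih _ (by omega) (by omega) rfl)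
    · exact h.le_of_height_succ T (by omega)

/-- Vertices of the same height compare like their parents. -/
theorem le_of_parent_le (h : G.IsExtremal k π f root) (T : G.Rooting root) {u v : V}
    (hu : u ≠ root) (hv : v ≠ root) (huv : G.height root u = G.height root v)
    (hne : T.top (T.par u) ≠ T.top (T.par v)) (hp : f (T.top (T.par v)) ≤ f (T.top (T.par u))) :
    f v ≤ f u := by
  have hhu := T.height_par hu
  have hhv := T.height_par hv
  rcases T.desc_or_linked_top (e₁ := T.par v) (e₂ := T.par u) (by omega) with
    ⟨q, hq, hqt, hd⟩ | hl
  · have h1 := T.height_eq _ (T.par_mem u hu) q hq hqt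
    have := hd.height_le
    omega
  · exact h.le_of_top_le T (T.par_mem u hu) (T.par_mem v hv) hne
      (hl.symm.mono fun _ _ h1 => h1.symm) hp (T.mem_par u hu) (T.ne_top_par u hu)
      (T.mem_par v hv) (T.ne_top_par v hv)

/-- Children of the same parent compare like the weights of their edges. -/
theorem le_of_par_sum_le (h : G.IsExtremal k π f root) (T : G.Rooting root) {u v : V}
    (hu : u ≠ root) (hv : v ≠ root) (hpar : T.par u ≠ T.par v)
    (ht : T.top (T.par u) = T.top (T.par v))
    (hs : ∑ x ∈ T.par v, f x ≤ ∑ x ∈ T.par u, f x) : f v ≤ f u := by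
  refine h.le_of_sum_le T (T.par_mem u hu) (T.par_mem v hv) hpar ?_ hs (T.mem_par u hu)
    (T.ne_top_par u hu) (T.mem_par v hv) (T.ne_top_par v hv)
  rw [ht]
  exact Linked.refl _

end IsExtremal

end FinHypergraph

/-! ### Construction of the ordering -/

namespace FinHypergraph

variable {V : Type u} [Fintype V] [DecidableEq V]

namespace Rooting

variable {G : FinHypergraph V} {root : V}

/-- The order on the vertices of height `n` in which vertices are compared first by their
ancestors, then by the keys `κ`. -/
def levelLT {α : Type*} [LT α] (T : G.Rooting root) (κ : V → α) : ℕ → V → V → Prop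
  | 0, _, _ => False
  | n + 1, u, v => T.levelLT κ n (T.top (T.par u)) (T.top (T.par v)) ∨
      T.top (T.par u) = T.top (T.par v) ∧ κ u < κ v

section

variable {α : Type*} [LinearOrder α] (T : G.Rooting root) (κ : V → α)

theorem levelLT_irrefl (n : ℕ) (u : V) : ¬ T.levelLT κ n u u := by
  induction n generalizing u with
  | zero => exact id
  | succ n ih =>
    rintro (h | h)
    · exact ih _ h
    · exact lt_irrefl _ h.2

theorem levelLT_trans {n : ℕ} {u v w : V} (h₁ : T.levelLT κ n u v) (h₂ : T.levelLT κ n v w) :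
    T.levelLT κ n u w := by
  induction n generalizing u v w with
  | zero => exact h₁
  | succ n ih =>
    rcases h₁ with h₁ | ⟨h₁, h₁'⟩ <;> rcases h₂ with h₂ | ⟨h₂, h₂'⟩
    · exact .inl (ih h₁ h₂)
    · exact .inl (h₂ ▸ h₁)
    · exact .inl (h₁ ▸ h₂)
    · exact .inr ⟨h₁.trans h₂, h₁'.trans h₂'⟩

theorem levelLT_trichotomous (hκ : Function.Injective κ) {n : ℕ} {u v : V}
    (hu : G.height root u = n) (hv : G.height root v = n) :
    T.levelLT κ n u v ∨ u = v ∨ T.levelLT κ n v u := by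
  induction n generalizing u v with
  | zero =>
    rw [height_eq_zero T.connected] at hu hv
    exact .inr (.inl (hu.trans hv.symm))
  | succ n ih =>
    have hu0 : u ≠ root := fun h => by rw [h, height_root] at hu; omega
    have hv0 : v ≠ root := fun h => by rw [h, height_root] at hv; omega
    have h1 := T.height_par hu0
    have h2 := T.height_par hv0
    rcases ih (u := T.top (T.par u)) (v := T.top (T.par v)) (by omega) (by omega) with h | h | h
    · exact .inl (.inl h)
    · rcases lt_trichotomy (κ u) (κ v) with h' | h' | h'
      · exact .inl (.inr ⟨h, h'⟩)
      · exact .inr (.inl (hκ h'))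
      · exact .inr (.inr (.inr ⟨h.symm, h'⟩))
    · exact .inr (.inr (.inl h))

/-- The vertices ordered by height, and within each level by `levelLT`. -/
def treeLT (u v : V) : Prop :=
  G.height root u < G.height root v ∨
    G.height root u = G.height root v ∧ T.levelLT κ (G.height root u) u v

variable {T κ}

theorem treeLT.height_le {u v : V} (h : T.treeLT κ u v) :
    G.height root u ≤ G.height root v := by
  rcases h with h | h
  · exact h.le
  · exact h.1.le

theorem treeLT.levelLT {u v : V} (h : T.treeLT κ u v)
    (huv : G.height root u = G.height root v) : T.levelLT κ (G.height root u) u v := by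
  rcases h with h | h
  · omega
  · exact h.2

theorem isWellOrder_treeLT (hκ : Function.Injective κ) : IsWellOrder V (T.treeLT κ) := by
  have htrans : ∀ u v w, T.treeLT κ u v → T.treeLT κ v w → T.treeLT κ u w := by
    rintro u v w (h₁ | ⟨h₁, h₁'⟩) (h₂ | ⟨h₂, h₂'⟩)
    · exact .inl (h₁.trans h₂)
    · exact .inl (h₂ ▸ h₁)
    · exact .inl (h₁ ▸ h₂)
    · exact .inr ⟨h₁.trans h₂, T.levelLT_trans κ h₁' (h₁ ▸ h₂')⟩
  have hirr : ∀ u, ¬ T.treeLT κ u u := by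
    rintro u (h | h)
    · exact lt_irrefl _ h
    · exact T.levelLT_irrefl κ _ u h.2
  have htri : ∀ u v, T.treeLT κ u v ∨ u = v ∨ T.treeLT κ v u := by
    intro u v
    rcases lt_trichotomy (G.height root u) (G.height root v) with h | h | h
    · exact .inl (.inl h)
    · rcases T.levelLT_trichotomous κ hκ h rfl with h' | h' | h'
      · exact .inl (.inr ⟨h, h.symm ▸ h'⟩)
      · exact .inr (.inl h')
      · exact .inr (.inr (.inr ⟨h.symm, h'⟩))
    · exact .inr (.inr (.inl h))
  have : IsTrans V (T.treeLT κ) := ⟨htrans⟩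
  have : Std.Irrefl (T.treeLT κ) := ⟨hirr⟩
  exact { trichotomous := fun u v h1 h2 => ((htri u v).resolve_left h1).resolve_right h2
          wf := Finite.wellFounded_of_trans_of_irrefl _ }

theorem treeLT_of_isParent {u v u₁ v₁ : V} (hu : G.IsParent root u u₁)
    (hv : G.IsParent root v v₁) (huv : T.treeLT κ u v) : T.treeLT κ u₁ v₁ := by
  have h1 := hu.2
  have h2 := hv.2
  rw [T.isParent_iff] at hu hv
  rcases huv with h | ⟨h, h'⟩
  · exact .inl (by omega)
  · refine .inr ⟨by omega, ?_⟩
    rw [h1]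
    left
    rw [← hu.2, ← hv.2]
    exact h'

/-- The top precedes the rest of its edge, so `x` and `y` are lower vertices of `e`. The vertex `v`
between them has the same parent, hence a key between theirs, and `hblock` places it in the same
edge. -/
theorem mem_of_treeLT_of_treeLT (hblock : ∀ x y v, T.par x = T.par y → κ x < κ v → κ v < κ y →
      T.par v = T.par x) {e : Finset V} (he : e ∈ G.edges) {a x y v : V}
    (ha : a ∈ e) (hx : x ∈ e) (hy : y ∈ e) (hax : T.treeLT κ a x) (hxv : T.treeLT κ x v)
    (hvy : T.treeLT κ v y) : v ∈ e := by
  have hxt : x ≠ T.top e := by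
    intro h
    by_cases hat : a = T.top e
    · rcases hax with h1 | h1
      · rw [h, hat] at h1
        exact lt_irrefl _ h1
      · rw [h, hat] at h1
        exact T.levelLT_irrefl κ _ _ h1.2
    · have h1 := T.height_eq e he a ha hat
      have h2 := hax.height_le
      rw [h] at h2
      omega
  have hx1 := T.height_eq e he x hx hxt
  have h1 := hxv.height_le
  have h2 := hvy.height_le
  have hyt : y ≠ T.top e := fun h => by rw [h] at h2; omega
  have hy1 := T.height_eq e he y hy hyt
  have hv0 : v ≠ root := fun h => by rw [h, height_root] at h1; omega
  have h3 := hxv.levelLT (by omega)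
  have h4 := hvy.levelLT (by omega)
  have hv1 : G.height root v = G.height root (T.top e) + 1 := by omega
  have hpx := T.par_eq e he x hx hxt
  have hpy := T.par_eq e he y hy hyt
  rw [hx1] at h3
  rw [hv1] at h4
  simp only [Rooting.levelLT, hpx, hpy] at h3 h4
  rcases h3 with h3 | ⟨h3, h3'⟩ <;> rcases h4 with h4 | ⟨h4, h4'⟩
  · exact absurd (T.levelLT_trans κ h3 h4) (T.levelLT_irrefl κ _ _)
  · exact absurd (h4 ▸ h3) (T.levelLT_irrefl κ _ _)
  · exact absurd (h3 ▸ h4) (T.levelLT_irrefl κ _ _)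
  · have := hblock x y v (hpx.trans hpy.symm) h3' h4'
    rw [← hpx, ← this]
    exact T.mem_par v hv0

theorem le_of_treeLT {f : V → ℝ}
    (h₁ : ∀ u v, G.height root u < G.height root v → f v ≤ f u)
    (h₂ : ∀ u v, u ≠ root → v ≠ root → G.height root u = G.height root v →
      T.top (T.par u) ≠ T.top (T.par v) → f (T.top (T.par v)) ≤ f (T.top (T.par u)) → f v ≤ f u)
    (h₃ : ∀ u v, u ≠ root → v ≠ root → T.top (T.par u) = T.top (T.par v) → κ u < κ v →
      f v ≤ f u) {u v : V} (huv : T.treeLT κ u v) : f v ≤ f u := by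
  have key : ∀ n u v, G.height root u = n → G.height root v = n → T.levelLT κ n u v →
      f v ≤ f u := by
    intro n
    induction n with
    | zero => exact fun u v _ _ h => h.elim
    | succ n ih =>
      intro u v hu hv h
      have hu0 : u ≠ root := fun h => by rw [h, height_root] at hu; omega
      have hv0 : v ≠ root := fun h => by rw [h, height_root] at hv; omega
      have h4 := T.height_par hu0
      have h5 := T.height_par hv0
      rcases h with h | ⟨h, h'⟩
      · refine h₂ u v hu0 hv0 (by omega) (fun h6 => ?_) (ih _ _ (by omega) (by omega) h)
        rw [h6] at h
        exact T.levelLT_irrefl κ _ _ h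
      · exact h₃ u v hu0 hv0 h h'
  rcases huv with h | ⟨h, h'⟩
  · exact h₁ u v h
  · exact key _ u v rfl h.symm h'

end

/-- A rooted supertree with a weight function that is compatible with heights, parents and edges
has an ordering with the properties of a spiral-like ordering that do not involve degrees. -/
theorem exists_wellOrder (T : G.Rooting root) (f : V → ℝ)
    (h₁ : ∀ u v, G.height root u < G.height root v → f v ≤ f u)
    (h₂ : ∀ u v, u ≠ root → v ≠ root → G.height root u = G.height root v →
      T.top (T.par u) ≠ T.top (T.par v) → f (T.top (T.par v)) ≤ f (T.top (T.par u)) → f v ≤ f u)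
    (h₃ : ∀ u v, u ≠ root → v ≠ root → T.par u ≠ T.par v → T.top (T.par u) = T.top (T.par v) →
      ∑ x ∈ T.par v, f x ≤ ∑ x ∈ T.par u, f x → f v ≤ f u) :
    ∃ r : V → V → Prop, IsWellOrder V r ∧
      (∀ u v, r u v → G.height root u ≤ G.height root v) ∧
      (∀ u v u₁ v₁, G.IsParent root u u₁ → G.IsParent root v v₁ → r u v → r u₁ v₁) ∧
      (∀ e ∈ G.edges, ∀ a ∈ e, ∀ x ∈ e, ∀ y ∈ e, r a x → ∀ v, r x v → r v y → v ∈ e) ∧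
      ∀ u v, r u v → f v ≤ f u := by
  obtain ⟨i, hi⟩ := Countable.exists_injective_nat (Finset V)
  obtain ⟨j, hj⟩ := Countable.exists_injective_nat V
  -- Heavier edges come first. The index of the edge keeps the vertices of one edge together when
  -- weights tie, as (S4) requires; then larger values of `f` come first, and the index of the
  -- vertex makes the key injective.
  let κ : V → ℝ ×ₗ ℕ ×ₗ ℝ ×ₗ ℕ := fun v =>
    toLex (-∑ x ∈ T.par v, f x, toLex (i (T.par v), toLex (-f v, j v)))
  have hκ : Function.Injective κ := by
    intro u v h
    simp only [κ, EmbeddingLike.apply_eq_iff_eq, Prod.mk.injEq] at h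
    exact hj h.2.2.2
  refine ⟨T.treeLT κ, isWellOrder_treeLT hκ, fun u v h => h.height_le,
    fun u v u₁ v₁ hu hv h => treeLT_of_isParent hu hv h,
    fun e he a ha x hx y hy hax v hxv hvy => mem_of_treeLT_of_treeLT ?_ he ha hx hy hax hxv hvy,
    fun u v h => le_of_treeLT h₁ h₂ ?_ h⟩
  · intro x y v hxy hxv hvy
    apply hi
    simp only [κ, Prod.Lex.toLex_lt_toLex, hxy] at hxv hvy ⊢
    rcases hxv with h1 | ⟨h1, h1'⟩ <;> rcases hvy with h2 | ⟨h2, h2'⟩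
    · linarith
    · linarith
    · linarith
    · rcases h1' with h1' | ⟨h1', -⟩ <;> rcases h2' with h2' | ⟨h2', -⟩ <;> omega
  · intro u v hu hv ht huv
    simp only [κ, Prod.Lex.toLex_lt_toLex] at huv
    by_cases hp : T.par u = T.par v
    · simp only [hp, lt_irrefl, false_or, true_and] at huv
      rcases huv with h | h
      · linarith
      · linarith [h.1]
    · refine h₃ u v hu hv hp ht ?_
      rcases huv with h | h
      · linarith
      · linarith [h.1]

end Rooting

end FinHypergraph

namespace FinHypergraph

variable {V : Type u} [Fintype V] [DecidableEq V]

/-! ### Shifting edges from one vertex to another -/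

section Shift

variable {G : FinHypergraph V} {k : ℕ} {π : Multiset ℕ} {f : V → ℝ}

theorem sum_le_of_forall_le {e : Finset V} (hcard : e.card = k) {u : V} (hu : u ∈ e) {c : ℝ}
    (h : ∀ x ∈ e, x ≠ u → f x ≤ c) : ∑ x ∈ e, f x - f u ≤ ((k : ℝ) - 1) * c := by
  rw [← Finset.sum_erase_eq_sub hu]
  have h1 := Finset.sum_le_card_nsmul (e.erase u) f c fun x hx =>
    h x (Finset.mem_of_mem_erase hx) (Finset.ne_of_mem_erase hx)
  have h2 : (((e.erase u).card : ℕ) : ℝ) = (k : ℝ) - 1 := by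
    rw [Finset.card_erase_of_mem hu, hcard, Nat.cast_sub, Nat.cast_one]
    rw [← hcard]
    exact Finset.card_pos.2 ⟨u, hu⟩
  rwa [nsmul_eq_mul, h2] at h1

/-- In a Faber–Krahn supertree it is impossible to exchange the degrees of two vertices by moving
light edges from the vertex with the larger value of the ground state to the other one. -/
theorem IsGroundState.shift_false (hk : 2 ≤ k) (hFK : G.HasFaberKrahn k π)
    (hf : G.IsGroundState k f) {u v : V} (huv : u ≠ v) (hu : ¬ G.IsBoundary u)
    (hv : ¬ G.IsBoundary v) {M : Finset (Finset V)} (hM : M ⊆ G.edges)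
    (huM : ∀ e ∈ M, u ∈ e) (hvM : ∀ e ∈ M, v ∉ e) (hdeg : G.degree u = G.degree v + M.card)
    (hl : G.Linked (· ∉ M) u v) (hvu : f v ≤ f u) (hle : ∀ e ∈ M, ∀ x ∈ e, x ≠ u → f x ≤ f v)
    {l : Finset V} (hlM : l ∈ M) (hls : ∑ x ∈ l, f x < k * f u) : False := by
  obtain ⟨hunif, hT, hseq⟩ := hFK.1
  have hk' : (0 : ℝ) < (k : ℝ) - 1 := by
    have : (2 : ℝ) ≤ k := by exact_mod_cast hk
    linarith
  let φ : Finset V → Finset V := fun e => if e ∈ M then insert v (e.erase u) else e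
  have hφM : ∀ e ∈ M, φ e = insert v (e.erase u) := fun e he => by simp [φ, he]
  have hφ : ∀ e, e ∉ M → φ e = e := fun e he => by simp [φ, he]
  have hφne : ∀ e ∈ G.edges, (φ e).Nonempty := by
    intro e he
    by_cases h : e ∈ M
    · rw [hφM e h]
      exact Finset.insert_nonempty _ _
    · rw [hφ e h]
      exact G.nonempty_of_mem e he
  have hφcard : ∀ e ∈ G.edges, (φ e).card ≤ k := by
    intro e he
    by_cases h : e ∈ M
    · rw [hφM e h]
      exact (card_insert_erase_le (huM e h)).trans (hunif e he).le
    · rw [hφ e h]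
      exact (hunif e he).le
  set H := G.mapEdges φ hφne with hH
  have hmem : ∀ e ∈ G.edges, φ e ∈ H.edges := fun e he => Finset.mem_image_of_mem _ he
  have hl' : H.adjGraph.Reachable u v := hl.reachable fun e he h => by
    rw [← hφ e h]
    exact hmem e he
  have hHc : H.adjGraph.Connected := by
    have := hT.1.nonempty
    refine ⟨fun x y => reachable_of_forall_edge ?_ (hT.1.preconnected x y)⟩
    intro e he
    by_cases h : e ∈ M
    · have hv' : ∀ x ∈ e, H.adjGraph.Reachable x v := by
        intro x hx
        by_cases hxu : x = u
        · rw [hxu]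
          exact hl'
        · have h1 := hmem e he
          rw [hφM e h] at h1
          exact reachable_of_mem h1 (Finset.mem_insert_of_mem (Finset.mem_erase.2 ⟨hxu, hx⟩))
            (Finset.mem_insert_self _ _)
      exact fun x hx y hy => (hv' x hx).trans (hv' y hy).symm
    · have h1 := hmem e he
      rw [hφ e h] at h1
      exact fun x hx y hy => reachable_of_mem h1 hx hy
  obtain ⟨hinj, hHu, hHT⟩ := mapEdges_isSupertree hk hunif hT hφne hφcard hHc
  have hdH : ∀ w, (H.degree w : ℤ) = G.degree w +
      ∑ e ∈ M, ((if w ∈ insert v (e.erase u) then 1 else 0) - (if w ∈ e then 1 else 0)) := by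
    intro w
    rw [degree_eq_sum, degree_eq_sum, hH, sum_mapEdges hφne hinj]
    push_cast
    rw [← Finset.sum_sdiff hM, ← Finset.sum_sdiff hM]
    rw [Finset.sum_congr rfl fun e he => by rw [hφ e (Finset.mem_sdiff.1 he).2],
      Finset.sum_congr (s₁ := M) rfl fun e he => by rw [hφM e he], Finset.sum_sub_distrib]
    ring
  have hdu : H.degree u = G.degree v := by
    have h1 := hdH u
    rw [Finset.sum_congr (g := fun _ => (-1 : ℤ)) rfl fun e he => by simp [huv, huM e he]] at h1
    rw [Finset.sum_const, nsmul_eq_mul] at h1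
    zify
    zify at hdeg
    linarith
  have hdv : H.degree v = G.degree u := by
    have h1 := hdH v
    rw [Finset.sum_congr (g := fun _ => (1 : ℤ)) rfl fun e he => by simp [hvM e he]] at h1
    rw [Finset.sum_const, nsmul_eq_mul] at h1
    zify
    zify at hdeg
    linarith
  have hdw : ∀ w, w ≠ u → w ≠ v → H.degree w = G.degree w := by
    intro w hwu hwv
    have h1 := hdH w
    rw [Finset.sum_eq_zero fun e he => by simp [hwu, hwv]] at h1
    zify
    linarith
  -- Since `|M| = d(u) - d(v)`, the degrees of `u` and `v` are exchanged and the multiset is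
  -- unchanged.
  have hclass : H.MemClass k π := ⟨hHu, hHT, by
    have h1 : H.degree = G.degree ∘ Equiv.swap u v := by
      funext w
      by_cases hwu : w = u
      · simp [hwu, hdu]
      by_cases hwv : w = v
      · simp [hwv, hdv]
      simp [hdw w hwu hwv, Equiv.swap_apply_of_ne_of_ne hwu hwv]
    rw [← hseq, degreeSequence, degreeSequence, h1, ← Multiset.map_map]
    congr 1
    exact Multiset.map_univ_val_equiv _⟩
  have hbd : ∀ w, H.IsBoundary w ↔ G.IsBoundary w := by
    intro w
    unfold IsBoundary at *
    by_cases hwu : w = u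
    · subst hwu
      rw [hdu]
      exact iff_of_false hv hu
    by_cases hwv : w = v
    · subst hwv
      rw [hdv]
      exact iff_of_false hu hv
    rw [hdw w hwu hwv]
  -- With `s` the weight of `e \ u`, the change is `(f u - f v) (2 s - (k - 1) (f u + f v))`, and `s
  -- ≤ (k - 1) f v`.
  have hq : ∀ e ∈ M, edgeEnergy k f (φ e) ≤ edgeEnergy k f e - ((k : ℝ) - 1) * (f u - f v) ^ 2 := by
    intro e he
    have h1 := sum_le_of_forall_le (hunif e (hM he)) (huM e he) (hle e he)
    rw [hφM e he]
    simp only [edgeEnergy, sum_insert_erase (huM e he) (hvM e he)]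
    have h2 := mul_le_mul_of_nonneg_left h1 (sub_nonneg.2 hvu)
    nlinarith
  have hqE : ∀ e ∈ G.edges, edgeEnergy k f (φ e) ≤ edgeEnergy k f e := by
    intro e he
    by_cases h : e ∈ M
    · have := hq e h
      have : 0 ≤ ((k : ℝ) - 1) * (f u - f v) ^ 2 := by positivity
      linarith
    · rw [hφ e h]
  have hener : H.energy k f = ∑ e ∈ G.edges, edgeEnergy k f (φ e) := by
    rw [energy, hH, sum_mapEdges hφne hinj]
  obtain ⟨hE, hlap⟩ := hf.compare hk hFK hclass hbd ⟨u, hu⟩ (by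
    rw [hener]
    exact Finset.sum_le_sum hqE)
  rw [hener, energy, Finset.sum_eq_sum_iff_of_le hqE] at hE
  have hfuv : f u = f v := by
    have h1 := hE l (hM hlM)
    have h2 := hq l hlM
    have h3 : ((k : ℝ) - 1) * (f u - f v) ^ 2 ≤ 0 := by linarith
    have h4 : (f u - f v) ^ 2 ≤ 0 := by
      by_contra h5
      have := mul_pos hk' (not_le.1 h5)
      linarith
    have := pow_eq_zero_iff (two_ne_zero) |>.1 (le_antisymm h4 (sq_nonneg _))
    linarith
  -- At `u` the moved edges have lost their nonnegative terms `k f u - ∑ f`, the one of `l` being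
  -- positive, while the Laplacian is unchanged.
  have h1 := hlap u hu
  rw [lapSum_eq_sum, lapSum_eq_sum, hH, sum_mapEdges hφne hinj] at h1
  have h2 : ∀ e ∈ G.edges, (if u ∈ φ e then k * f u - ∑ x ∈ φ e, f x else 0) ≤
      if u ∈ e then k * f u - ∑ x ∈ e, f x else 0 := by
    intro e he
    by_cases h : e ∈ M
    · have h3 := sum_le_of_forall_le (hunif e he) (huM e h) (hle e h)
      rw [hφM e h, if_neg (by simp [huv]), if_pos (huM e h)]
      rw [← hfuv] at h3
      linarith
    · rw [hφ e h]
  have h3 := (Finset.sum_eq_sum_iff_of_le h2).1 h1 l (hM hlM)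
  rw [hφM l hlM, if_neg (by simp [huv]), if_pos (huM l hlM)] at h3
  linarith

end Shift

/-! ### Positivity of the first eigenvalue -/

section Positive

variable {G : FinHypergraph V} {k : ℕ} {π : Multiset ℕ} {f : V → ℝ} {root : V}

theorem Rooting.exists_isBoundary (T : G.Rooting root) (hk : 2 ≤ k) (hG : G.IsUniform k)
    (hne : ∃ v, v ≠ root) : ∃ v, G.IsBoundary v := by
  obtain ⟨v, -, hv⟩ := (Finset.univ : Finset V).exists_max_image (G.height root)
    ⟨root, Finset.mem_univ _⟩
  have hv0 : v ≠ root := by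
    rintro rfl
    obtain ⟨w, hw⟩ := hne
    have h1 := hv w (Finset.mem_univ _)
    rw [height_root, Nat.le_zero, height_eq_zero T.connected] at h1
    exact hw h1
  refine ⟨v, ?_⟩
  by_contra hb
  obtain ⟨e, he, ht, -⟩ := T.exists_top_eq hb (T.par_mem v hv0) (T.mem_par v hv0)
    (T.ne_top_par v hv0)
  obtain ⟨y, hy, hyt⟩ := exists_ne_of_uniform hk hG he (T.top e)
  have h1 := T.height_eq e he y hy hyt
  have h2 := hv y (Finset.mem_univ _)
  rw [ht] at h1
  omega

/-- A maximum principle: for eigenvalue zero, `f` would be constant by connectedness, but it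
vanishes on the boundary and is positive at the root. -/
theorem IsExtremal.eigenvalue_pos (h : G.IsExtremal k π f root) (T : G.Rooting root)
    (hne : ∃ v, v ≠ root) : 0 < ((k : ℝ) - 1) * G.firstDirichletEigenvalue := by
  have hunif := h.faberKrahn.1.isUniform
  have hterm : ∀ v, f v = f root → ∀ e ∈ G.edges.filter (fun e => v ∈ e),
      0 ≤ k * f v - ∑ x ∈ e, f x := by
    intro v hv e he
    have h1 := sum_le_of_forall_le (f := f) (hunif e (Finset.mem_filter.1 he).1)
      (Finset.mem_filter.1 he).2 (c := f v) fun x _ _ => hv ▸ h.le_root x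
    linarith
  have heq : ∀ v, f v = f root →
      G.lapSum k f v = ((k : ℝ) - 1) * G.firstDirichletEigenvalue * f v := fun v hv =>
    h.groundState.eq v (h.groundState.not_isBoundary (hv ▸ h.root_pos))
  have hnn : 0 ≤ ((k : ℝ) - 1) * G.firstDirichletEigenvalue := by
    have h1 := heq root rfl
    have h2 : 0 ≤ G.lapSum k f root := Finset.sum_nonneg (hterm root rfl)
    rw [h1] at h2
    exact nonneg_of_mul_nonneg_left h2 h.root_pos
  refine hnn.lt_of_ne fun h0 => ?_
  have hconst : ∀ v, f v = f root := by
    suffices key : ∀ v w, G.adjGraph.Walk v w → f w = f root → f v = f root by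
      intro v
      obtain ⟨p⟩ := T.connected.preconnected v root
      exact key v root p rfl
    intro v w p hw
    induction p with
    | nil => exact hw
    | cons hadj p ih =>
      obtain ⟨-, e, he, hx, hy⟩ := hadj
      rename_i a b c
      have hb := ih hw
      have h1 := heq b hb
      rw [← h0, zero_mul, lapSum, Finset.sum_eq_zero_iff_of_nonneg (hterm b hb)] at h1
      have h2 := h1 e (Finset.mem_filter.2 ⟨he, hy⟩)
      by_contra hne
      have hlt : f a < f root := lt_of_le_of_ne (h.le_root a) (fun h3 => hne h3)
      have h3 : ∑ x ∈ e, f x < ∑ _x ∈ e, f root :=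
        Finset.sum_lt_sum (fun x _ => h.le_root x) ⟨a, hx, hlt⟩
      rw [Finset.sum_const, hunif e he, nsmul_eq_mul, ← hb] at h3
      linarith
  obtain ⟨v, hv⟩ := T.exists_isBoundary h.two_le hunif hne
  have h1 := hconst v
  rw [h.groundState.zero v hv] at h1
  exact h.root_pos.ne h1

end Positive

end FinHypergraph

/-! ### Monotonicity of the degrees -/

namespace FinHypergraph

variable {V : Type u} [Fintype V] [DecidableEq V]

variable {G : FinHypergraph V} {k : ℕ} {π : Multiset ℕ} {f : V → ℝ} {root : V}

/-- Height bounds do not suffice to avoid edges hanging from `u` when `v` is below the level of `u`,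
so the edges on the path are recorded as parent edges of ancestors of `v`. -/
theorem Rooting.linked_par (T : G.Rooting root) (v : V) :
    G.Linked (fun c => ∃ w, w ≠ root ∧ T.Desc v w ∧ T.par w = c) v root := by
  have h := T.desc_root v
  induction h using Relation.ReflTransGen.head_induction_on with
  | refl => exact Linked.refl _
  | head h1 _ ih =>
    obtain ⟨h3, rfl⟩ := h1
    refine (linked_of_mem (T.par_mem _ h3) ⟨_, h3, Relation.ReflTransGen.refl, rfl⟩
      (T.mem_par _ h3) (T.top_par_mem h3)).trans (ih.mono ?_)
    rintro e - ⟨w, hw, hd, rfl⟩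
    exact ⟨w, hw, Relation.ReflTransGen.head ⟨h3, rfl⟩ hd, rfl⟩

/-- Consecutive interior vertices have non-decreasing degrees. -/
theorem IsExtremal.degree_le_of_covBy (h : G.IsExtremal k π f root) (T : G.Rooting root)
    {r : V → V → Prop} [IsWellOrder V r]
    (s₁ : ∀ u v, r u v → G.height root u ≤ G.height root v)
    (s₄ : ∀ e ∈ G.edges, ∀ a ∈ e, ∀ x ∈ e, ∀ y ∈ e, r a x → ∀ v, r x v → r v y → v ∈ e)
    (hfr : ∀ u v, r u v → f v ≤ f u) {u v : V} (hu : ¬ G.IsBoundary u) (hv : ¬ G.IsBoundary v)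
    (huv : r u v) (hcov : ∀ w, r u w → ¬ r w v) : G.degree u ≤ G.degree v := by
  by_contra hlt
  rw [not_le] at hlt
  have hunif := h.faberKrahn.1.isUniform
  have hr : ∀ {x y : V}, G.height root x < G.height root y → r x y := by
    intro x y hxy
    rcases trichotomous_of r x y with h1 | h1 | h1
    · exact h1
    · rw [h1] at hxy
      omega
    · have := s₁ _ _ h1
      omega
  have hirr : ∀ x, ¬ r x x := irrefl_of r
  have huvne : u ≠ v := fun h1 => hirr v (h1 ▸ huv)
  have hv0 : v ≠ root := by
    rintro rfl
    have h1 := s₁ _ _ huv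
    rw [height_root, Nat.le_zero, height_eq_zero T.connected] at h1
    exact huvne h1
  have hdv : 2 ≤ G.degree v := by
    have h1 : 0 < G.degree v :=
      Finset.card_pos.2 ⟨T.par v, Finset.mem_filter.2 ⟨T.par_mem v hv0, T.mem_par v hv0⟩⟩
    have h2 : G.degree v ≠ 1 := hv
    omega
  -- The edges that can be moved. At most two edges at `u` are not among them, `par u` and `par v`,
  -- and `d(v) ≥ 2`, so `d(u) - d(v)` movable edges are available. As nothing lies between `u` and
  -- `v`, their lower vertices follow `v`.
  let C := G.edges.filter fun e => T.top e = u ∧ v ∉ e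
  have hC : ∀ e ∈ C, e ∈ G.edges ∧ T.top e = u ∧ v ∉ e := fun e he => Finset.mem_filter.1 he
  have hCh : ∀ e ∈ C, ∀ x ∈ e, x ≠ u → G.height root x = G.height root u + 1 := by
    intro e he x hx hxu
    obtain ⟨h1, h2, -⟩ := hC e he
    rw [T.height_eq e h1 x hx (by rw [h2]; exact hxu), h2]
  have hCr : ∀ e ∈ C, ∀ x ∈ e, x ≠ u → r v x := by
    intro e he x hx hxu
    rcases trichotomous_of r v x with h1 | h1 | h1
    · exact h1
    · exact absurd (h1 ▸ hx) (hC e he).2.2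
    · exact absurd h1 (hcov x (hr (by rw [hCh e he x hx hxu]; omega)))
  have hcard : G.degree u ≤ C.card + 2 := by
    have h1 : G.edges.filter (fun e => u ∈ e) ⊆ insert (T.par v) (insert (T.par u) C) := by
      intro e he
      obtain ⟨he, hue⟩ := Finset.mem_filter.1 he
      simp only [Finset.mem_insert]
      by_cases ht : u = T.top e
      · by_cases hve : v ∈ e
        · exact .inl (T.par_eq e he v hve (ht ▸ huvne.symm)).symm
        · exact .inr (.inr (Finset.mem_filter.2 ⟨he, ht.symm, hve⟩))
      · exact .inr (.inl (T.par_eq e he u hue ht).symm)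
    calc G.degree u ≤ _ := Finset.card_le_card h1
      _ ≤ _ := Finset.card_insert_le _ _
      _ ≤ _ := Nat.add_le_add_right (Finset.card_insert_le _ _) 1
  have hstrict : ∀ e ∈ C, (∀ x ∈ e, x ≠ u → f x < f u) → ∑ x ∈ e, f x < k * f u := by
    intro e he hx
    obtain ⟨h1, h2, -⟩ := hC e he
    obtain ⟨y, hy, hyu⟩ := exists_ne_of_uniform h.two_le hunif h1 u
    have h3 : ∑ x ∈ e, f x < ∑ _x ∈ e, f u := by
      refine Finset.sum_lt_sum (fun x hxe => ?_) ⟨y, hy, hx y hy hyu⟩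
      by_cases hxu : x = u
      · rw [hxu]
      · exact (hx x hxe hxu).le
    rwa [Finset.sum_const, hunif e h1, nsmul_eq_mul] at h3
  obtain ⟨c, hc⟩ : C.Nonempty := Finset.card_pos.1 (by omega)
  have hl : ∃ l ∈ C, ∑ x ∈ l, f x < k * f u := by
    rcases (hfr u v huv).lt_or_eq with hfuv | hfuv
    · exact ⟨c, hc, hstrict c hc fun x hx hxu => (hfr _ _ (hCr c hc x hx hxu)).trans_lt hfuv⟩
    -- When `f u = f v`, positivity of the eigenvalue yields an edge `e` at `u` with a vertex `x`
    -- satisfying `f x < f u`. Either `e` is movable itself, or the lower vertices of `c` come after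
    -- `x`.
    · have hpos : 0 < G.lapSum k f u := by
        rw [h.groundState.eq u hu]
        exact mul_pos (h.eigenvalue_pos T ⟨v, hv0⟩) (h.groundState.pos u hu)
      obtain ⟨e, he, hes⟩ : ∃ e ∈ G.edges.filter (fun e => u ∈ e), 0 < k * f u - ∑ x ∈ e, f x := by
        by_contra hall
        push Not at hall
        exact absurd hpos (not_lt.2 (Finset.sum_nonpos hall))
      obtain ⟨he, hue⟩ := Finset.mem_filter.1 he
      obtain ⟨x, hx, hxu⟩ : ∃ x ∈ e, f x < f u := by
        by_contra hall
        push Not at hall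
        have h1 : ∑ _x ∈ e, f u ≤ ∑ x ∈ e, f x := Finset.sum_le_sum hall
        rw [Finset.sum_const, hunif e he, nsmul_eq_mul] at h1
        linarith
      by_cases ht : u = T.top e
      · by_cases hve : v ∈ e
        · refine ⟨c, hc, hstrict c hc fun y hy hyu => ?_⟩
          have hvx : r v x := by
            rcases trichotomous_of r v x with h1 | h1 | h1
            · exact h1
            · rw [← h1, hfuv] at hxu
              exact absurd hxu (lt_irrefl _)
            · have := hfr _ _ h1
              linarith
          have hye : y ∉ e := by
            intro hye
            obtain ⟨h1, h2, h3⟩ := hC c hc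
            have h4 := T.par_eq e he y hye (ht ▸ hyu)
            have h5 := T.par_eq c h1 y hy (by rw [h2]; exact hyu)
            exact h3 (h5 ▸ h4 ▸ hve)
          have hxy : r x y := by
            rcases trichotomous_of r x y with h1 | h1 | h1
            · exact h1
            · exact absurd (h1 ▸ hx) hye
            -- Otherwise `y` would lie between `v` and `x`, two lower vertices of `e`, and (S4)
            -- would put it in `e`.
            · exact absurd (s₄ e he u hue v hve x hx huv y (hCr c hc y hy hyu) h1) hye
          exact (hfr _ _ hxy).trans_lt hxu
        · exact ⟨e, Finset.mem_filter.2 ⟨he, ht.symm, hve⟩, by linarith⟩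
      · refine ⟨c, hc, hstrict c hc fun y hy hyu => ?_⟩
        have h1 := T.height_eq e he u hue ht
        have hxt : x ≠ T.top e := fun h2 => by
          have := h.le_top T he hue
          rw [← h2] at this
          linarith
        have h2 := T.height_eq e he x hx hxt
        have h3 := hCh c hc y hy hyu
        exact (hfr _ _ (hr (by omega))).trans_lt hxu
  obtain ⟨l, hlC, hls⟩ := hl
  obtain ⟨M, hlM, hMC, hMcard⟩ := Finset.exists_subsuperset_card_eq
    (Finset.singleton_subset_iff.2 hlC) (n := G.degree u - G.degree v)
    (by rw [Finset.card_singleton]; omega) (by omega)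
  refine h.groundState.shift_false h.two_le h.faberKrahn huvne hu hv
    (fun e he => (hC e (hMC he)).1) (fun e he => ?_) (fun e he => (hC e (hMC he)).2.2)
    (by omega) ?_ (hfr u v huv) (fun e he x hx hxu => hfr _ _ (hCr e (hMC he) x hx hxu))
    (Finset.singleton_subset_iff.1 hlM) hls
  · obtain ⟨h1, h2, -⟩ := hC e (hMC he)
    exact h2 ▸ T.top_mem e h1
  -- The edges above `u` have tops lower than `u`. An ancestor of `v` with parent edge in `M` would
  -- follow `v`, which its height allows only for `v` itself, and `v` lies in no edge of `M`.
  · refine Linked.trans ((T.desc_root u).linked.mono ?_) ((T.linked_par v).mono ?_).symm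
    · rintro e - ⟨-, h1⟩ heM
      rw [(hC e (hMC heM)).2.1] at h1
      omega
    · rintro e - ⟨w, hw, hd, rfl⟩ heM
      have hwu : w ≠ u := fun h1 => T.ne_top_par w hw (by rw [(hC _ (hMC heM)).2.1, h1])
      have h1 := hCr _ (hMC heM) w (T.mem_par w hw) hwu
      have h2 := hd.height_le
      rcases h2.lt_or_eq with h3 | h3
      · exact hirr v (trans_of r h1 (hr h3))
      · rcases Relation.ReflTransGen.cases_head hd with h4 | ⟨y, ⟨hy1, rfl⟩, h5⟩
        · exact hirr v (h4 ▸ h1)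
        · have h6 := T.height_par hy1
          have h7 := Rooting.Desc.height_le h5
          omega

/-- Interior vertices have non-decreasing degrees along the order. -/
theorem IsExtremal.degree_le (h : G.IsExtremal k π f root) (T : G.Rooting root)
    {r : V → V → Prop} [IsWellOrder V r]
    (s₁ : ∀ u v, r u v → G.height root u ≤ G.height root v)
    (s₄ : ∀ e ∈ G.edges, ∀ a ∈ e, ∀ x ∈ e, ∀ y ∈ e, r a x → ∀ v, r x v → r v y → v ∈ e)
    (hfr : ∀ u v, r u v → f v ≤ f u) {u v : V} (hu : ¬ G.IsBoundary u) (hv : ¬ G.IsBoundary v)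
    (huv : r u v) : G.degree u ≤ G.degree v := by
  classical
  induction hn : (Finset.univ.filter fun w => r u w ∧ r w v).card using Nat.strong_induction_on
    generalizing u v with
  | _ n ih =>
    by_cases hcov : ∀ w, r u w → ¬ r w v
    · exact h.degree_le_of_covBy T s₁ s₄ hfr hu hv huv hcov
    · push Not at hcov
      obtain ⟨w, huw, hwv⟩ := hcov
      -- Here `f w ≥ f v > 0`, so a chain of consecutive vertices from `u` to `v` stays in the
      -- interior.
      have hw : ¬ G.IsBoundary w :=
        h.groundState.not_isBoundary ((h.groundState.pos v hv).trans_le (hfr _ _ hwv))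
      have hwmem : w ∈ Finset.univ.filter fun x => r u x ∧ r x v :=
        Finset.mem_filter.2 ⟨Finset.mem_univ _, huw, hwv⟩
      have h1 : (Finset.univ.filter fun x => r u x ∧ r x w).card < n := by
        rw [← hn]
        refine Finset.card_lt_card ⟨fun x hx => ?_, fun h2 => ?_⟩
        · obtain ⟨-, hx1, hx2⟩ := Finset.mem_filter.1 hx
          exact Finset.mem_filter.2 ⟨Finset.mem_univ _, hx1, trans_of r hx2 hwv⟩
        · exact irrefl_of r w (Finset.mem_filter.1 (h2 hwmem)).2.2
      have h2 : (Finset.univ.filter fun x => r w x ∧ r x v).card < n := by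
        rw [← hn]
        refine Finset.card_lt_card ⟨fun x hx => ?_, fun h2 => ?_⟩
        · obtain ⟨-, hx1, hx2⟩ := Finset.mem_filter.1 hx
          exact Finset.mem_filter.2 ⟨Finset.mem_univ _, trans_of r huw hx1, hx2⟩
        · exact irrefl_of r w (Finset.mem_filter.1 (h2 hwmem)).2.1
      exact (ih _ h1 hu hw huw rfl).trans (ih _ h2 hw hv hwv rfl)

/-- A supertree with the Faber–Krahn property has a spiral-like ordering. -/
theorem HasFaberKrahn.hasSLO (hk : 2 ≤ k) (hFK : G.HasFaberKrahn k π) : G.HasSLO := by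
  have hne := hFK.1.isSupertree.1.nonempty
  by_cases hint : ∃ v, ¬ G.IsBoundary v
  · obtain ⟨f, hf⟩ := exists_groundState hk hFK.1.isUniform hFK.1.isSupertree.1 hint
    obtain ⟨root, hroot⟩ := Finite.exists_max f
    have h : G.IsExtremal k π f root := ⟨hk, hFK, hf, hint, hroot⟩
    obtain ⟨T⟩ := hFK.1.isSupertree.nonempty_rooting root
    obtain ⟨r, hr, s₁, s₂, s₄, hfr⟩ := T.exists_wellOrder f (fun _ _ => h.le_of_height_lt T)
      (fun _ _ => h.le_of_parent_le T) (fun _ _ => h.le_of_par_sum_le T)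
    refine ⟨root, r, hr, s₁, s₂, fun u v huv hu => ?_, s₄,
      fun u v hu hv huv => h.degree_le T s₁ s₄ hfr hu hv huv⟩
    by_contra hv
    have h1 := hfr u v huv
    rw [hf.zero u hu] at h1
    exact absurd (hf.pos v hv) (not_lt.2 h1)
  · push Not at hint
    obtain ⟨root⟩ := hne
    obtain ⟨T⟩ := hFK.1.isSupertree.nonempty_rooting root
    -- Without interior vertices (S3) and (S5) are void, and the zero weight satisfies all
    -- comparisons.
    obtain ⟨r, hr, s₁, s₂, s₄, -⟩ := T.exists_wellOrder (fun _ => 0) (by simp) (by simp) (by simp)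
    exact ⟨root, r, hr, s₁, s₂, fun _ v _ _ => hint v, s₄, fun u _ hu => absurd (hint u) hu⟩

end FinHypergraph

/-! ### Reading the edges off a spiral-like ordering -/

namespace FinHypergraph

variable {V : Type u} [Fintype V] [DecidableEq V]

namespace IsSLO

variable {G : FinHypergraph V} {k : ℕ} {root : V} {r : V → V → Prop}

theorem lt_or_eq_or_gt (h : G.IsSLO root r) (x y : V) : r x y ∨ x = y ∨ r y x := by
  have := h.isWellOrder
  exact trichotomous_of r x y

theorem irrefl (h : G.IsSLO root r) (x : V) : ¬ r x x := by
  have := h.isWellOrder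
  exact irrefl_of r x

theorem trans (h : G.IsSLO root r) {x y z : V} (hxy : r x y) (hyz : r y z) : r x z := by
  have := h.isWellOrder
  exact trans_of r hxy hyz

theorem asymm (h : G.IsSLO root r) {x y : V} (hxy : r x y) : ¬ r y x :=
  fun hyx => h.irrefl x (h.trans hxy hyx)

theorem lt_of_height_lt (h : G.IsSLO root r) {x y : V}
    (hxy : G.height root x < G.height root y) : r x y := by
  rcases h.lt_or_eq_or_gt x y with h1 | h1 | h1
  · exact h1
  · rw [h1] at hxy
    omega
  · have := h.s1 _ _ h1
    omega

theorem root_lt (h : G.IsSLO root r) (hG : G.adjGraph.Connected) {x : V} (hx : x ≠ root) :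
    r root x := by
  refine h.lt_of_height_lt ?_
  rw [height_root]
  exact Nat.pos_of_ne_zero fun h1 => hx ((height_eq_zero hG).1 h1)

theorem lt_of_parent_lt (h : G.IsSLO root r) (T : G.Rooting root) {u v : V} (hu : u ≠ root)
    (hv : v ≠ root) (huv : r (T.top (T.par u)) (T.top (T.par v))) : r u v :=
  h.s2 _ _ _ _ (T.isParent_iff.2 ⟨hu, rfl⟩) (T.isParent_iff.2 ⟨hv, rfl⟩) huv

/-- A vertex between two lower vertices of an edge is a lower vertex of that edge. -/
theorem par_eq_of_between (h : G.IsSLO root r) (T : G.Rooting root) {e : Finset V}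
    (he : e ∈ G.edges) {x y w : V} (hx : x ∈ e) (hxt : x ≠ T.top e) (hy : y ∈ e)
    (hxw : r x w) (hwy : r w y) : T.par w = e := by
  have h1 := T.height_eq e he x hx hxt
  have h2 : r (T.top e) x := h.lt_of_height_lt (by omega)
  refine T.par_eq e he w (h.s4 e he _ (T.top_mem e he) x hx y hy h2 w hxw hwy) fun h3 => ?_
  have := h.s1 _ _ hxw
  rw [h3] at this
  omega

open Classical in
/-- The edges whose lower vertices precede `w`. -/
noncomputable def edgesBefore (T : G.Rooting root) (r : V → V → Prop) (w : V) :
    Finset (Finset V) :=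
  G.edges.filter fun e => ∀ x ∈ e, x ≠ T.top e → r x w

theorem mem_edgesBefore {T : G.Rooting root} {e : Finset V} {w : V} :
    e ∈ edgesBefore T r w ↔ e ∈ G.edges ∧ ∀ x ∈ e, x ≠ T.top e → r x w := by
  classical
  simp [edgesBefore]

/-- If one lower vertex of an edge other than `par w` precedes `w`, then all of them do. -/
theorem mem_edgesBefore_of_lt (h : G.IsSLO root r) {T : G.Rooting root} {e : Finset V}
    (he : e ∈ G.edges) {w : V} (hw : T.par w ≠ e) {x : V} (hx : x ∈ e) (hxt : x ≠ T.top e)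
    (hxw : r x w) : e ∈ edgesBefore T r w := by
  refine mem_edgesBefore.2 ⟨he, fun y hy hyt => ?_⟩
  rcases h.lt_or_eq_or_gt y w with h1 | h1 | h1
  · exact h1
  · exact absurd (h1 ▸ T.par_eq e he y hy hyt) hw
  · exact absurd (h.par_eq_of_between T he hx hxt hy hxw h1) hw

theorem par_notMem_edgesBefore (h : G.IsSLO root r) {T : G.Rooting root} {w : V}
    (hw : w ≠ root) : T.par w ∉ edgesBefore T r w := fun h1 =>
  h.irrefl w ((mem_edgesBefore.1 h1).2 w (T.mem_par w hw) (T.ne_top_par w hw))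

open Classical in
/-- The position of a vertex determines the number of edges before it. -/
theorem card_edgesBefore (h : G.IsSLO root r) (T : G.Rooting root)
    (hG : G.IsUniform k) {w : V} (hw : w ≠ root) :
    (edgesBefore T r w).card = ((Finset.univ.filter fun x => r x w).card - 1) / (k - 1) := by
  have hcardlow : ∀ e ∈ G.edges, (e.erase (T.top e)).card = k - 1 := fun e he => by
    rw [Finset.card_erase_of_mem (T.top_mem e he), hG e he]
  have h1 : ((Finset.univ.filter fun x => r x w).erase root).card =
      ∑ e ∈ G.edges, ((e.erase (T.top e)).filter fun x => r x w).card := by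
    rw [Finset.card_eq_sum_card_fiberwise (f := T.par) (t := G.edges)
      (fun x hx => T.par_mem x (Finset.ne_of_mem_erase hx))]
    refine Finset.sum_congr rfl fun e he => ?_
    congr 1
    rw [← T.filter_par_eq he]
    ext x
    simp only [Finset.mem_filter, Finset.mem_erase, Finset.mem_univ, true_and]
    tauto
  -- An edge other than `par w` has all or none of its `k - 1` lower vertices before `w`. The edge
  -- `par w` contributes fewer than `k - 1`, which the division discards; the `- 1` in the statement
  -- accounts for the root.
  have h2 : ∀ e ∈ G.edges.erase (T.par w), ((e.erase (T.top e)).filter fun x => r x w).card =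
      if e ∈ edgesBefore T r w then k - 1 else 0 := by
    intro e he
    obtain ⟨hne, he⟩ := Finset.mem_erase.1 he
    split_ifs with h3
    · rw [Finset.filter_true_of_mem, hcardlow e he]
      intro x hx
      exact (mem_edgesBefore.1 h3).2 x (Finset.mem_of_mem_erase hx) (Finset.ne_of_mem_erase hx)
    · rw [Finset.card_eq_zero, Finset.filter_eq_empty_iff]
      intro x hx hxw
      exact h3 (h.mem_edgesBefore_of_lt he hne.symm (Finset.mem_of_mem_erase hx)
        (Finset.ne_of_mem_erase hx) hxw)
  rw [Finset.card_erase_of_mem (by simpa using h.root_lt T.connected hw),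
    ← Finset.add_sum_erase _ _ (T.par_mem w hw), Finset.sum_congr rfl h2, ← Finset.sum_filter,
    Finset.sum_const, smul_eq_mul] at h1
  have h3 : (G.edges.erase (T.par w)).filter (fun e => e ∈ edgesBefore T r w) =
      edgesBefore T r w := by
    ext e
    simp only [Finset.mem_filter, Finset.mem_erase]
    exact ⟨fun h4 => h4.2, fun h4 => ⟨⟨fun h5 => h.par_notMem_edgesBefore hw (h5 ▸ h4),
      (mem_edgesBefore.1 h4).1⟩, h4⟩⟩
  have h4 : (((T.par w).erase (T.top (T.par w))).filter fun x => r x w).card < k - 1 := by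
    rw [← hcardlow _ (T.par_mem w hw)]
    refine Finset.card_lt_card (Finset.filter_ssubset.2 ⟨w, ?_, h.irrefl w⟩)
    exact Finset.mem_erase.2 ⟨T.ne_top_par w hw, T.mem_par w hw⟩
  rw [h3] at h1
  rw [h1, Nat.add_mul_div_right _ _ (by omega), Nat.div_eq_of_lt h4, zero_add]

theorem edgesBefore_subset (h : G.IsSLO root r) {T : G.Rooting root} {w w' : V} (hww' : r w w') :
    edgesBefore T r w ⊆ edgesBefore T r w' := fun _ he =>
  mem_edgesBefore.2 ⟨(mem_edgesBefore.1 he).1, fun x hx hxt =>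
    h.trans ((mem_edgesBefore.1 he).2 x hx hxt) hww'⟩

theorem card_edgesBefore_lt (h : G.IsSLO root r) {T : G.Rooting root} {w w' : V} (hw : w ≠ root)
    (hww' : r w w') (hne : T.par w ≠ T.par w') :
    (edgesBefore T r w).card < (edgesBefore T r w').card :=
  Finset.card_lt_card ⟨h.edgesBefore_subset hww', fun h1 =>
    h.par_notMem_edgesBefore hw (h1 (h.mem_edgesBefore_of_lt (T.par_mem w hw) hne.symm
      (T.mem_par w hw) (T.ne_top_par w hw) hww'))⟩

theorem edgesBefore_eq_of_par_eq (h : G.IsSLO root r) {T : G.Rooting root} {w w' : V}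
    (hw : w ≠ root) (hw' : w' ≠ root) (hpar : T.par w = T.par w') (hww' : r w w') :
    edgesBefore T r w = edgesBefore T r w' := by
  refine Finset.Subset.antisymm (h.edgesBefore_subset hww') fun e he => ?_
  obtain ⟨he, hall⟩ := mem_edgesBefore.1 he
  have hne : T.par w ≠ e := fun h1 =>
    h.irrefl w' (hall w' (h1 ▸ hpar ▸ T.mem_par w' hw') (h1 ▸ hpar ▸ T.ne_top_par w' hw'))
  refine mem_edgesBefore.2 ⟨he, fun x hx hxt => ?_⟩
  rcases h.lt_or_eq_or_gt x w with h1 | h1 | h1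
  · exact h1
  · exact absurd (h1 ▸ T.par_eq e he x hx hxt) hne
  · refine absurd ?_ hne
    rw [← T.par_eq e he x hx hxt]
    exact (h.par_eq_of_between T (T.par_mem w hw) (T.mem_par w hw) (T.ne_top_par w hw)
      (hpar ▸ T.mem_par w' hw') h1 (hall x hx hxt)).symm

/-- The count is constant on the lower vertices of an edge and grows strictly from one edge to the
next, so it identifies the parent edge. -/
theorem par_eq_iff (h : G.IsSLO root r) (T : G.Rooting root) {w w' : V} (hw : w ≠ root)
    (hw' : w' ≠ root) :
    T.par w = T.par w' ↔ (edgesBefore T r w).card = (edgesBefore T r w').card := by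
  rcases h.lt_or_eq_or_gt w w' with h1 | h1 | h1
  · refine ⟨fun h2 => by rw [h.edgesBefore_eq_of_par_eq hw hw' h2 h1], fun h2 => ?_⟩
    by_contra h3
    exact (h.card_edgesBefore_lt hw h1 h3).ne h2
  · rw [h1]
    simp
  · refine ⟨fun h2 => by rw [h.edgesBefore_eq_of_par_eq hw' hw h2.symm h1], fun h2 => ?_⟩
    by_contra h3
    exact (h.card_edgesBefore_lt hw' h1 (Ne.symm h3)).ne h2.symm

open Classical in
/-- The edges whose top is at most `u`. -/
noncomputable def edgesUpTo (T : G.Rooting root) (r : V → V → Prop) (u : V) :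
    Finset (Finset V) :=
  G.edges.filter fun e => r (T.top e) u ∨ T.top e = u

theorem mem_edgesUpTo {T : G.Rooting root} {e : Finset V} {u : V} :
    e ∈ edgesUpTo T r u ↔ e ∈ G.edges ∧ (r (T.top e) u ∨ T.top e = u) := by
  classical
  simp [edgesUpTo]

/-- By (S2) edges appear in the order of their tops: those hanging from vertices up to `u` form an
initial segment, and `par w` belongs to it exactly when fewer edges than its size come before. -/
theorem top_par_le_iff (h : G.IsSLO root r) (T : G.Rooting root) (hk : 2 ≤ k)
    (hG : G.IsUniform k) {w : V} (hw : w ≠ root) (u : V) :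
    (r (T.top (T.par w)) u ∨ T.top (T.par w) = u) ↔
      (edgesBefore T r w).card < (edgesUpTo T r u).card := by
  constructor
  · intro hle
    refine Finset.card_lt_card ⟨fun e he => ?_, fun h1 => h.par_notMem_edgesBefore hw
      (h1 (mem_edgesUpTo.2 ⟨T.par_mem w hw, hle⟩))⟩
    obtain ⟨he, hall⟩ := mem_edgesBefore.1 he
    refine mem_edgesUpTo.2 ⟨he, ?_⟩
    obtain ⟨x, hx, hxt⟩ := exists_ne_of_uniform hk hG he (T.top e)
    rcases h.lt_or_eq_or_gt (T.top e) (T.top (T.par w)) with h1 | h1 | h1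
    · rcases hle with h2 | h2
      · exact .inl (h.trans h1 h2)
      · exact .inl (h2 ▸ h1)
    · rw [h1]
      exact hle
    · refine absurd (hall x hx hxt) (h.asymm (h.lt_of_parent_lt T hw (T.ne_root he hx hxt) ?_))
      rwa [T.par_eq e he x hx hxt]
  · intro hlt
    by_contra hnle
    rw [not_or] at hnle
    have hu : r u (T.top (T.par w)) := by
      rcases h.lt_or_eq_or_gt u (T.top (T.par w)) with h1 | h1 | h1
      · exact h1
      · exact absurd h1.symm hnle.2
      · exact absurd h1 hnle.1
    refine absurd hlt (not_lt.2 (Finset.card_le_card fun e he => ?_))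
    obtain ⟨he, hle⟩ := mem_edgesUpTo.1 he
    have h1 : r (T.top e) (T.top (T.par w)) := by
      rcases hle with h2 | h2
      · exact h.trans h2 hu
      · exact h2 ▸ hu
    refine mem_edgesBefore.2 ⟨he, fun x hx hxt =>
      h.lt_of_parent_lt T (T.ne_root he hx hxt) hw ?_⟩
    rwa [T.par_eq e he x hx hxt]

/-- Every edge at `x` hangs from `x` except the parent edge, which the root lacks. -/
theorem card_filter_top_eq (T : G.Rooting root) (x : V) :
    (G.edges.filter fun e => T.top e = x).card = G.degree x - if x = root then 0 else 1 := by
  by_cases hx : x = root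
  · rw [if_pos hx, Nat.sub_zero, degree]
    congr 1
    ext e
    simp only [Finset.mem_filter]
    refine and_congr_right fun he => ⟨fun h1 => h1 ▸ T.top_mem e he, fun h1 => ?_⟩
    by_contra h2
    exact T.ne_root he h1 (Ne.symm h2) hx
  · rw [if_neg hx, degree, ← Finset.card_erase_of_mem
      (Finset.mem_filter.2 ⟨T.par_mem x hx, T.mem_par x hx⟩)]
    congr 1
    ext e
    simp only [Finset.mem_filter, Finset.mem_erase]
    constructor
    · rintro ⟨he, rfl⟩
      refine ⟨fun h1 => T.ne_top_par _ hx (by rw [← h1]), he, T.top_mem e he⟩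
    · rintro ⟨h1, he, hxe⟩
      refine ⟨he, ?_⟩
      by_contra h2
      exact h1 (T.par_eq e he x hxe (Ne.symm h2)).symm

open Classical in
theorem card_edgesUpTo (T : G.Rooting root) (u : V) :
    (edgesUpTo T r u).card =
      ∑ x ∈ Finset.univ.filter (fun x => r x u ∨ x = u),
        (G.degree x - if x = root then 0 else 1) := by
  rw [Finset.card_eq_sum_card_fiberwise (f := T.top)
    (t := Finset.univ.filter (fun x => r x u ∨ x = u)) (fun e he => by
      simpa using (mem_edgesUpTo.1 he).2)]
  refine Finset.sum_congr rfl fun x hx => ?_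
  rw [← card_filter_top_eq T x]
  congr 1
  ext e
  simp only [Finset.mem_filter, mem_edgesUpTo]
  constructor
  · rintro ⟨⟨h1, -⟩, h2⟩
    exact ⟨h1, h2⟩
  · rintro ⟨h1, rfl⟩
    exact ⟨⟨h1, (Finset.mem_filter.1 hx).2⟩, rfl⟩

end IsSLO

/-! ### Uniqueness of the ordered supertree -/

section Unique

variable {W : Type u} [Fintype W] [DecidableEq W] {G : FinHypergraph V} {H : FinHypergraph W}
  {k : ℕ} {rootG : V} {rootH : W} {r : V → V → Prop} {s : W → W → Prop}

/-- A bijection that preserves spiral-like orderings and degrees maps edges to edges. -/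
theorem IsSLO.map_mem_edges (hr : G.IsSLO rootG r) (hs : H.IsSLO rootH s) (hk : 2 ≤ k)
    (hGu : G.IsUniform k) (hHu : H.IsUniform k) (T : G.Rooting rootG) (S : H.Rooting rootH)
    (φ : V ≃ W) (hφ : ∀ x y, r x y ↔ s (φ x) (φ y)) (hdeg : ∀ x, H.degree (φ x) = G.degree x)
    {e : Finset V} (he : e ∈ G.edges) : e.map φ.toEmbedding ∈ H.edges := by
  classical
  have hroot : φ rootG = rootH := by
    by_contra hne
    have h1 := hs.root_lt S.connected hne
    rw [← φ.apply_symm_apply rootH, ← hφ] at h1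
    have h2 := hr.root_lt T.connected (x := φ.symm rootH) (fun h3 => hne (by rw [← h3]; simp))
    exact hr.asymm h1 h2
  have hne : ∀ x, x ≠ rootG ↔ φ x ≠ rootH := fun x => by
    rw [← hroot]
    simp
  have hpos : ∀ w, (Finset.univ.filter fun y => s y (φ w)).card =
      (Finset.univ.filter fun x => r x w).card := by
    intro w
    refine (Finset.card_equiv φ fun x => ?_).symm
    simp [hφ]
  have hbefore : ∀ w, w ≠ rootG → (edgesBefore S s (φ w)).card = (edgesBefore T r w).card := by
    intro w hw
    rw [hr.card_edgesBefore T hGu hw, hs.card_edgesBefore S hHu ((hne w).1 hw), hpos]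
  have hupto : ∀ u, (edgesUpTo S s (φ u)).card = (edgesUpTo T r u).card := by
    intro u
    rw [card_edgesUpTo, card_edgesUpTo]
    refine (Finset.sum_equiv φ (fun x => ?_) fun x _ => ?_).symm
    · simp [hφ]
    · rw [hdeg]
      congr 1
      rw [← hroot]
      simp
  -- The parent of a vertex is characterized by the vertices `u` that are not before it, and by
  -- `top_par_le_iff` this depends only on positions and degrees, which `φ` preserves.
  have htop : ∀ w, w ≠ rootG → φ (T.top (T.par w)) = S.top (S.par (φ w)) := by
    intro w hw
    have key : ∀ u, (r (T.top (T.par w)) u ∨ T.top (T.par w) = u) ↔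
        (s (S.top (S.par (φ w))) (φ u) ∨ S.top (S.par (φ w)) = φ u) := by
      intro u
      rw [hr.top_par_le_iff T hk hGu hw, hs.top_par_le_iff S hk hHu ((hne w).1 hw), hbefore w hw,
        hupto]
    have h1 := (key (T.top (T.par w))).1 (.inr rfl)
    have h2 := (key (φ.symm (S.top (S.par (φ w))))).2 (by simp)
    rw [hφ, φ.apply_symm_apply, ← φ.apply_eq_iff_eq, φ.apply_symm_apply] at h2
    rcases h1 with h1 | h1
    · rcases h2 with h2 | h2
      · exact absurd h2 (hs.asymm h1)
      · exact h2
    · exact h1.symm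
  have hpar : ∀ w w', w ≠ rootG → w' ≠ rootG →
      (T.par w = T.par w' ↔ S.par (φ w) = S.par (φ w')) := by
    intro w w' hw hw'
    rw [hr.par_eq_iff T hw hw', hs.par_eq_iff S ((hne w).1 hw) ((hne w').1 hw'), hbefore w hw,
      hbefore w' hw']
  obtain ⟨w, hwe, hwt⟩ := exists_ne_of_uniform hk hGu he (T.top e)
  have hw := T.ne_root he hwe hwt
  have hwp := T.par_eq e he w hwe hwt
  have hmem := S.par_mem _ ((hne w).1 hw)
  have hsub : e.map φ.toEmbedding ⊆ S.par (φ w) := by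
    intro y hy
    obtain ⟨x, hx, rfl⟩ := Finset.mem_map.1 hy
    rw [Equiv.coe_toEmbedding]
    by_cases hxt : x = T.top e
    · rw [hxt, ← hwp, htop w hw]
      exact S.top_mem _ hmem
    · have hx0 := T.ne_root he hx hxt
      have hxp := T.par_eq e he x hx hxt
      rw [← (hpar x w hx0 hw).1 (hxp.trans hwp.symm)]
      exact S.mem_par _ ((hne x).1 hx0)
  rw [Finset.eq_of_subset_of_card_le hsub (by
    rw [Finset.card_map, hGu e he, hHu _ hmem])]
  exact hmem

end Unique

end FinHypergraph

namespace FinHypergraph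

/-! ### Degrees along the ordering -/

section Enumeration

variable {V : Type u} [Fintype V] [DecidableEq V]

theorem exists_fin_equiv (r : V → V → Prop) [IsWellOrder V r] {n : ℕ} (hn : Fintype.card V = n) :
    ∃ α : Fin n ≃ V, ∀ i j, i < j ↔ r (α i) (α j) := by
  classical
  let _ : LinearOrder V := linearOrderOfSTO r
  let α := monoEquivOfFin V hn
  exact ⟨α.toEquiv, fun i j => (α.lt_iff_lt (x := i) (y := j)).symm⟩

theorem MemClass.card_eq {G : FinHypergraph V} {k : ℕ} {π : Multiset ℕ} (h : G.MemClass k π) :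
    Fintype.card V = π.card := by
  rw [← h.degreeSequence_eq, degreeSequence, Multiset.card_map, Finset.card_val, Finset.card_univ]

/-- Degrees, with the boundary degree `1` moved to the end. -/
noncomputable def degreeKey (d : ℕ) : ℕ∞ := if d = 1 then ⊤ else d

theorem degreeKey_injective : Function.Injective degreeKey := by
  intro a b h
  unfold degreeKey at h
  split_ifs at h with h1 h2 h2
  · omega
  · exact absurd h.symm (ENat.natCast_ne_top b)
  · exact absurd h (ENat.natCast_ne_top a)
  · exact_mod_cast h

/-- (S3) puts the boundary last and (S5) sorts the interior degrees. The degree list is then a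
sorted rearrangement of `π`, hence determined by it. -/
theorem IsSLO.ofFn_degreeKey_sorted {G : FinHypergraph V} {root : V} {r : V → V → Prop}
    (h : G.IsSLO root r) {n : ℕ} {α : Fin n ≃ V} (hα : ∀ i j, i < j ↔ r (α i) (α j)) :
    (List.ofFn fun i => degreeKey (G.degree (α i))).SortedLE := by
  refine Monotone.sortedLE_ofFn fun i j hij => ?_
  rcases hij.lt_or_eq with h1 | h1
  · rw [hα] at h1
    by_cases hj : G.IsBoundary (α j)
    · have : degreeKey (G.degree (α j)) = ⊤ := if_pos hj
      simp only [this, le_top]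
    · have hi : ¬ G.IsBoundary (α i) := fun hi => hj (h.s3 _ _ h1 hi)
      have h2 := h.s5 _ _ hi hj h1
      unfold IsBoundary at hi hj
      simp only [degreeKey, if_neg hi, if_neg hj]
      exact_mod_cast h2
  · rw [h1]

/-- Spiral-like orderings of supertrees with the same degree sequence visit the same degrees. -/
theorem IsSLO.degree_eq {W : Type u} [Fintype W] [DecidableEq W] {G : FinHypergraph V}
    {H : FinHypergraph W} {rootG : V} {rootH : W} {r : V → V → Prop} {s : W → W → Prop}
    (hr : G.IsSLO rootG r) (hs : H.IsSLO rootH s) (hd : G.degreeSequence = H.degreeSequence)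
    {n : ℕ} {α : Fin n ≃ V} (hα : ∀ i j, i < j ↔ r (α i) (α j)) {β : Fin n ≃ W}
    (hβ : ∀ i j, i < j ↔ s (β i) (β j)) (i : Fin n) : H.degree (β i) = G.degree (α i) := by
  have hperm : (List.ofFn fun i => degreeKey (H.degree (β i))).Perm
      (List.ofFn fun i => degreeKey (G.degree (α i))) := by
    rw [← Multiset.coe_eq_coe, ← Fin.univ_val_map, ← Fin.univ_val_map]
    have h1 : ∀ {U : Type u} [Fintype U] (γ : Fin n ≃ U) (d : U → ℕ),
        (Finset.univ : Finset (Fin n)).val.map (fun i => degreeKey (d (γ i))) =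
          (((Finset.univ : Finset U).val.map d).map degreeKey) := by
      intro U _ γ d
      rw [← Multiset.map_univ_val_equiv γ, Multiset.map_map, Multiset.map_map]
      rfl
    rw [h1, h1]
    exact congrArg _ hd.symm
  have h2 := hperm.eq_of_sortedLE (hs.ofFn_degreeKey_sorted hβ) (hr.ofFn_degreeKey_sorted hα)
  exact degreeKey_injective (congrFun (List.ofFn_injective h2) i)

/-- Supertrees with spiral-like orderings and the same degree sequence are isomorphic. -/
theorem HasSLO.isIsomorphic {W : Type u} [Fintype W] [DecidableEq W] {G : FinHypergraph V}
    {H : FinHypergraph W} {k : ℕ} {π : Multiset ℕ} (hk : 2 ≤ k) (hG : G.MemClass k π)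
    (hH : H.MemClass k π) (hGs : G.HasSLO) (hHs : H.HasSLO) : G.IsIsomorphic H := by
  obtain ⟨rootG, r, hr⟩ := hGs
  obtain ⟨rootH, s, hs⟩ := hHs
  obtain ⟨T⟩ := hG.isSupertree.nonempty_rooting rootG
  obtain ⟨S⟩ := hH.isSupertree.nonempty_rooting rootH
  have := hr.isWellOrder
  have := hs.isWellOrder
  obtain ⟨α, hα⟩ := exists_fin_equiv r hG.card_eq
  obtain ⟨β, hβ⟩ := exists_fin_equiv s hH.card_eq
  have hd := hr.degree_eq hs (hG.degreeSequence_eq.trans hH.degreeSequence_eq.symm) hα hβ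
  let φ : V ≃ W := α.symm.trans β
  have hφ : ∀ x y, r x y ↔ s (φ x) (φ y) := by
    intro x y
    simp only [φ, Equiv.trans_apply, ← hβ, hα, Equiv.apply_symm_apply]
  have hφd : ∀ x, H.degree (φ x) = G.degree x := by
    intro x
    simp only [φ, Equiv.trans_apply, hd, Equiv.apply_symm_apply]
  refine ⟨φ, fun e => ⟨hr.map_mem_edges hs hk hG.isUniform hH.isUniform T S φ hφ hφd,
    fun he => ?_⟩⟩
  have h1 := hs.map_mem_edges hr hk hH.isUniform hG.isUniform S T φ.symm
    (fun x y => by rw [hφ]; simp) (fun x => by rw [← hφd]; simp) he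
  rw [Finset.map_map] at h1
  simpa using h1

end Enumeration

/-! ### Invariance under isomorphism and existence -/

section Transport

variable {V W : Type u} {G : FinHypergraph V} {H : FinHypergraph W}

theorem IsIsomorphic.symm (h : G.IsIsomorphic H) : H.IsIsomorphic G := by
  obtain ⟨φ, hφ⟩ := h
  refine ⟨φ.symm, fun e => ?_⟩
  rw [hφ, Finset.map_map]
  simp

theorem sum_edges_of_equiv {M : Type*} [AddCommMonoid M] {φ : V ≃ W}
    (hφ : ∀ e : Finset V, e ∈ G.edges ↔ e.map φ.toEmbedding ∈ H.edges) (F : Finset W → M) :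
    ∑ e ∈ H.edges, F e = ∑ e ∈ G.edges, F (e.map φ.toEmbedding) :=
  (Finset.sum_equiv φ.finsetCongr (fun e => by simp [hφ, Equiv.finsetCongr])
    fun e _ => by simp [Equiv.finsetCongr]).symm

variable [DecidableEq V] [DecidableEq W]

theorem degree_of_equiv {φ : V ≃ W}
    (hφ : ∀ e : Finset V, e ∈ G.edges ↔ e.map φ.toEmbedding ∈ H.edges) (v : V) :
    H.degree (φ v) = G.degree v := by
  rw [degree, degree, Finset.card_filter, Finset.card_filter, sum_edges_of_equiv hφ]
  simp

theorem lapMatrix_of_equiv {φ : V ≃ W}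
    (hφ : ∀ e : Finset V, e ∈ G.edges ↔ e.map φ.toEmbedding ∈ H.edges) (i j : V) :
    H.lapMatrix (φ i) (φ j) = G.lapMatrix i j := by
  simp only [lapMatrix, Matrix.sub_apply, Matrix.diagonal_apply, φ.apply_eq_iff_eq,
    degree_of_equiv hφ, adjMatrix, Matrix.of_apply, Finset.sum_filter, sum_edges_of_equiv hφ,
    Finset.mem_map_equiv, Equiv.symm_apply_apply, Finset.card_map]

variable [Fintype V] [Fintype W]

theorem IsIsomorphic.isDirichletEigenvalue (h : G.IsIsomorphic H) {μ : ℝ}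
    (hμ : G.IsDirichletEigenvalue μ) : H.IsDirichletEigenvalue μ := by
  obtain ⟨φ, hφ⟩ := h
  obtain ⟨f, hf, heq, h0⟩ := hμ
  have hb : ∀ v, H.IsBoundary (φ v) ↔ G.IsBoundary v := fun v => by
    rw [IsBoundary, IsBoundary, degree_of_equiv hφ]
  refine ⟨f ∘ φ.symm, fun h1 => hf ?_, fun w hw => ?_, fun w hw => ?_⟩
  · funext v
    have := congrFun h1 (φ v)
    simpa using this
  · obtain ⟨v, rfl⟩ := φ.surjective w
    rw [hb] at hw
    rw [Function.comp_apply, φ.symm_apply_apply, ← heq v hw, Matrix.mulVec, Matrix.mulVec,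
      dotProduct, dotProduct]
    refine (Fintype.sum_equiv φ _ _ fun j => ?_).symm
    rw [lapMatrix_of_equiv hφ, Function.comp_apply, φ.symm_apply_apply]
  · obtain ⟨v, rfl⟩ := φ.surjective w
    rw [hb] at hw
    simpa using h0 v hw

theorem IsIsomorphic.firstDirichletEigenvalue_eq (h : G.IsIsomorphic H) :
    G.firstDirichletEigenvalue = H.firstDirichletEigenvalue := by
  rw [firstDirichletEigenvalue, firstDirichletEigenvalue]
  congr 1
  ext μ
  exact ⟨h.isDirichletEigenvalue, h.symm.isDirichletEigenvalue⟩

theorem IsIsomorphic.memClass (h : G.IsIsomorphic H) {k : ℕ} {π : Multiset ℕ}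
    (hG : G.MemClass k π) : H.MemClass k π := by
  obtain ⟨φ, hφ⟩ := h
  have hφ' : ∀ e : Finset W, e ∈ H.edges ↔ e.map φ.symm.toEmbedding ∈ G.edges := by
    intro e
    rw [hφ, Finset.map_map]
    simp
  refine ⟨fun e he => ?_, ⟨?_, ?_⟩, ?_⟩
  · rw [← hG.isUniform _ ((hφ' e).1 he), Finset.card_map]
  · have := hG.isSupertree.1.nonempty.map φ
    refine ⟨fun x y => ?_⟩
    obtain ⟨p⟩ := hG.isSupertree.1.preconnected (φ.symm x) (φ.symm y)
    let F : G.adjGraph →g H.adjGraph := ⟨φ, by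
      rintro a b ⟨hne, e, he, ha, hb⟩
      exact ⟨fun h1 => hne (φ.injective h1), _, (hφ e).1 he, by simpa using ha, by simpa using hb⟩⟩
    have := SimpleGraph.Reachable.map F ⟨p⟩
    simpa [F] using this
  · rintro ⟨m, x, e, hx, he, hxe⟩
    refine hG.isSupertree.2 ⟨m, fun i => φ.symm (x i), fun i => (e i).map φ.symm.toEmbedding,
      φ.symm.injective.comp hx, (Finset.map_injective _).comp he, fun i => ?_⟩
    exact ⟨(hφ' _).1 (hxe i).1, by simpa using (hxe i).2.1, by simpa using (hxe i).2.2⟩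
  · rw [← hG.degreeSequence_eq, degreeSequence, degreeSequence, ← Multiset.map_univ_val_equiv φ,
      Multiset.map_map]
    exact Multiset.map_congr rfl fun v _ => degree_of_equiv hφ v

/-- Every hypergraph can be transported along a bijection of the vertices. -/
theorem exists_isIsomorphic (H : FinHypergraph W) (ψ : W ≃ V) :
    ∃ H' : FinHypergraph V, H.IsIsomorphic H' := by
  refine ⟨⟨H.edges.map ψ.finsetCongr.toEmbedding, fun e he => ?_⟩, ψ, fun e => ?_⟩
  · obtain ⟨c, hc, rfl⟩ := Finset.mem_map.1 he
    simpa [Equiv.finsetCongr] using H.nonempty_of_mem c hc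
  · have : e.map ψ.toEmbedding = ψ.finsetCongr.toEmbedding e := rfl
    rw [this, Finset.mem_map']

/-- A class of supertrees that is not empty contains one with the Faber–Krahn property. -/
theorem MemClass.exists_hasFaberKrahn {k : ℕ} {π : Multiset ℕ} (hG : G.MemClass k π) :
    ∃ G' : FinHypergraph V, G'.HasFaberKrahn k π := by
  have : Finite (FinHypergraph V) :=
    Finite.of_injective FinHypergraph.edges fun _ _ h => FinHypergraph.ext h
  obtain ⟨G', hG', hmin⟩ := Set.exists_min_image {G' : FinHypergraph V | G'.MemClass k π}
    firstDirichletEigenvalue (Set.toFinite _) ⟨G, hG⟩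
  refine ⟨G', hG', fun U _ _ H hH => ?_⟩
  -- Members of `T_π` on other vertex sets have the same number of vertices, so the minimum over the
  -- finitely many hypergraphs on `V` is a minimum over the class.
  obtain ⟨H', hH'⟩ := exists_isIsomorphic H
    (Fintype.equivOfCardEq (hH.card_eq.trans hG.card_eq.symm))
  rw [hH'.firstDirichletEigenvalue_eq]
  exact hmin H' (hH'.memClass hH)

end Transport

end FinHypergraph

/-- Let `k ≥ 2`. A `k`-uniform supertree with degree sequence `π` has the Faber–Krahn property in
`T_π` if and only if it has an SLO-ordering. If `T_π` is non-empty, such an extremal supertree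
exists, and any two of them are isomorphic. -/
theorem mainTheorem1 (k : ℕ) (hk : 2 ≤ k) (π : Multiset ℕ) :
    (∀ (V : Type u) [Fintype V] [DecidableEq V] (G : FinHypergraph V),
      G.MemClass k π → (G.HasFaberKrahn k π ↔ G.HasSLO)) ∧
    (∀ (V : Type u) [Fintype V] [DecidableEq V] (G : FinHypergraph V),
      G.MemClass k π → ∃ G' : FinHypergraph V, G'.HasFaberKrahn k π) ∧
    (∀ (V W : Type u) [Fintype V] [DecidableEq V] [Fintype W] [DecidableEq W]
      (G : FinHypergraph V) (H : FinHypergraph W),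
      G.HasFaberKrahn k π → H.HasFaberKrahn k π → G.IsIsomorphic H) := by
  refine ⟨fun V _ _ G hG => ⟨fun h => h.hasSLO hk, fun h => ?_⟩,
    fun V _ _ G hG => hG.exists_hasFaberKrahn,
    fun V W _ _ _ _ G H hG hH => FinHypergraph.HasSLO.isIsomorphic hk hG.1 hH.1 (hG.hasSLO hk)
      (hH.hasSLO hk)⟩
  -- The converse needs no analysis: a minimizer has an SLO-ordering too, so `G` is isomorphic to it
  -- and has the same eigenvalue.
  obtain ⟨G', hG'⟩ := hG.exists_hasFaberKrahn
  have hiso := FinHypergraph.HasSLO.isIsomorphic hk hG hG'.1 h (hG'.hasSLO hk)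
  refine ⟨hG, fun W _ _ H hH => ?_⟩
  rw [hiso.firstDirichletEigenvalue_eq]
  exact hG'.2 W H hH
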